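/- **Setting.** Let $(\Gamma,d)$ be a countable metric space, and let $\mathcal H_x$ be a complex Hilbert space for each $x\in\Gamma$. For finite $\Lambda\subset\Gamma$ put $\mathcal H_\Lambda=\bigotimes_{x\in\Lambda}\mathcal H_x$ and $\mathcal A_\Lambda=\mathcal B(\mathcal H_\Lambda)$; for $X\subset\Lambda$ regard $\mathcal A_X\subset\mathcal A_\Lambda$ through $A\mapsto A\otimes 1_{\Lambda\setminus X}$. For every finite $Z\subset\Gamma$ and $t\in[0,1]$ let $\Phi_Z(t)=\Phi_Z(t)^*\in\mathcal A_Z$, and let $H_\Lambda(t)=\sum_{Z\subset\Lambda}\Phi_Z(t)$. Assume that $t\mapsto H_\Lambda(t)$ is strongly continuous on $[0,1]$ for every finite $\Lambda$. Let $U_\Lambda(t,s)$, $s,t\in[0,1]$, be the unitary propagators with $\frac{d}{dt}U_\Lambda(t,s)=-iH_\Lambda(t)U_\Lambda(t,s)$ (in the strong sense) and $U_\Lambda(s,s)=1$, and let $\tau_t^\Lambda(A)=U_\Lambda(t,0)^*AU_\Lambda(t,0)$ for $A\in\mathcal A_\Lambda$. **Theorem 4.4.** Let $F:[0,\infty)\to(0,\infty)$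 be non-increasing with $$\sup_{x\in\Gamma}\sum_{y\in\Gamma}F(d(x,y))<\infty ,$$ and let $C_F>0$ be a number with $$\sum_{z\in\Gamma}F(d(x,z))F(d(z,y))\le C_F\,F(d(x,y))\qquad\text{for all }x,y\in\Gamma .$$ Suppose that $$\|\Phi\|_F=\sup_{x,y\in\Gamma}\frac1{F(d(x,y))}\sum_{Z\ni x,y}\ \sup_{0\le t\le1}\|\Phi_Z(t)\|<\infty ,$$ where the sum is over the finite $Z\subset\Gamma$ containing $x$ and $y$. Then for all finite $\Lambda\subset\Gamma$, all $X,Y\subset\Lambda$, all $A\in\mathcal A_X$, $B\in\mathcal A_Y$ and all $t\in[0,1]$, $$\big\|[\tau_t^\Lambda(A),B]\big\|\le 2\|A\|\|B\|\min\Big[1,\ g(t)\sum_{x\in X,\,y\in Y}F(d(x,y))\Big],$$ where $$g(t)=\frac{e^{2\|\Phi\|_FC_F|t|}-1}{C_F}\quad\text{if }d(X,Y)>0,\qquad g(t)=\frac{e^{2\|\Phi\|_FC_F|t|}}{F(0)}\quad\text{otherwise}.$$ (If $X$ or $Y$ is empty, $d(X,Y)=\infty$. When $d(X,Y)=0$ the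 minimum equals $1$.) -/

import Mathlib

open scoped TensorProduct ComplexInnerProductSpace ENNReal

noncomputable section

set_option linter.unusedSectionVars false

namespace QLattice

/-! ### The Hilbert tensor product of a finite family of Hilbert spaces -/

section HilbertTensor

universe u v

variable {ι : Type u} [Fintype ι] (E : ι → Type v)
  [∀ i, NormedAddCommGroup (E i)] [∀ i, InnerProductSpace ℂ (E i)]

/-- The algebraic tensor product of the family `E`, as a type of its own: it carries the inner
product defined below, and not the seminorm that Mathlib puts on `PiTensorProduct`. -/
def AlgTensor : Type (max u v) := ⨂[ℂ] i, E i

instance : AddCommGroup (AlgTensor E) := inferInstanceAs (AddCommGroup (⨂[ℂ] i, E i))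
instance : Module ℂ (AlgTensor E) := inferInstanceAs (Module ℂ (⨂[ℂ] i, E i))

variable {E}

/-- The pure tensor `⨂ᵢ fᵢ`. -/
def AlgTensor.pure (f : ∀ i, E i) : AlgTensor E := PiTensorProduct.tprod ℂ f

theorem AlgTensor.span_pure :
    Submodule.span ℂ (Set.range (AlgTensor.pure (E := E))) = ⊤ :=
  PiTensorProduct.span_tprod_eq_top (R := ℂ) (s := E)

/-- `g ↦ ∏ᵢ ⟪fᵢ, gᵢ⟫` as a multilinear map. -/
def prodInner (f : ∀ i, E i) : MultilinearMap ℂ E ℂ :=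
  (MultilinearMap.mkPiAlgebra ℂ ι ℂ).compLinearMap (fun i => innerₛₗ ℂ (f i))

theorem prodInner_apply (f g : ∀ i, E i) : prodInner f g = ∏ i, ⟪f i, g i⟫ := by
  simp [prodInner]

theorem conj_prodInner (f g : ∀ i, E i) :
    (starRingEnd ℂ) (prodInner f g) = prodInner g f := by
  simp [prodInner_apply, map_prod]

/-- The functional `w ↦ ⟪⨂ᵢ fᵢ, w⟫` on the algebraic tensor product. -/
def innerLeft (f : ∀ i, E i) : AlgTensor E →ₗ[ℂ] ℂ := PiTensorProduct.lift (prodInner f)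

theorem innerLeft_pure (f g : ∀ i, E i) :
    innerLeft f (AlgTensor.pure g) = ∏ i, ⟪f i, g i⟫ := by
  rw [← prodInner_apply]; exact PiTensorProduct.lift.tprod _

/-- The antilinear functional `w ↦ ⟪w, ⨂ᵢ fᵢ⟫`. -/
def conjInnerLeft (f : ∀ i, E i) : AlgTensor E →ₗ⋆[ℂ] ℂ where
  toFun w := (starRingEnd ℂ) (innerLeft f w)
  map_add' := by simp
  map_smul' := by simp

theorem conjInnerLeft_pure (f g : ∀ i, E i) :
    conjInnerLeft f (AlgTensor.pure g) = prodInner g f := by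
  rw [← conj_prodInner, prodInner_apply, ← innerLeft_pure]; rfl

theorem antilinear_ext {φ ψ : AlgTensor E →ₗ⋆[ℂ] ℂ}
    (h : ∀ g, φ (AlgTensor.pure g) = ψ (AlgTensor.pure g)) : φ = ψ :=
  LinearMap.ext_on AlgTensor.span_pure (by rintro _ ⟨g, rfl⟩; exact h g)

/-- `f ↦ ⟪·, ⨂ᵢ fᵢ⟫` is multilinear. -/
def conjInnerMultilinear : MultilinearMap ℂ E (AlgTensor E →ₗ⋆[ℂ] ℂ) where
  toFun := conjInnerLeft
  map_update_add' f i x y := antilinear_ext fun g => by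
    rw [LinearMap.add_apply]
    simp only [conjInnerLeft_pure, MultilinearMap.map_update_add]
  map_update_smul' f i c x := antilinear_ext fun g => by
    rw [LinearMap.smul_apply]
    simp only [conjInnerLeft_pure, MultilinearMap.map_update_smul]

/-- The form `z ↦ (w ↦ ⟪w, z⟫)`. -/
def tensorForm : AlgTensor E →ₗ[ℂ] (AlgTensor E →ₗ⋆[ℂ] ℂ) :=
  PiTensorProduct.lift conjInnerMultilinear

theorem tensorForm_pure (f g : ∀ i, E i) :
    tensorForm (AlgTensor.pure f) (AlgTensor.pure g) = ∏ i, ⟪g i, f i⟫ := by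
  rw [← prodInner_apply, ← conjInnerLeft_pure]
  exact congrArg (fun φ : AlgTensor E →ₗ⋆[ℂ] ℂ => φ (AlgTensor.pure g))
    (PiTensorProduct.lift.tprod (φ := conjInnerMultilinear (E := E)) f)

@[elab_as_elim]
theorem AlgTensor.induction {p : AlgTensor E → Prop} (z : AlgTensor E) (h0 : p 0)
    (hp : ∀ f, p (AlgTensor.pure f)) (ha : ∀ x y, p x → p y → p (x + y))
    (hs : ∀ (c : ℂ) x, p x → p (c • x)) : p z := by
  have hz : z ∈ Submodule.span ℂ (Set.range (AlgTensor.pure (E := E))) := by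
    rw [AlgTensor.span_pure]; trivial
  induction hz using Submodule.span_induction with
  | mem x hx => obtain ⟨f, rfl⟩ := hx; exact hp f
  | zero => exact h0
  | add x y _ _ hx hy => exact ha x y hx hy
  | smul c x _ hx => exact hs c x hx

theorem tensorForm_conj (z w : AlgTensor E) :
    (starRingEnd ℂ) (tensorForm z w) = tensorForm w z := by
  induction z using AlgTensor.induction with
  | h0 => simp
  | hp f =>
    induction w using AlgTensor.induction with
    | h0 => simp
    | hp g => simp [tensorForm_pure, map_prod]
    | ha x y hx hy => simp [hx, hy]
    | hs c x hx => simp [hx]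
  | ha x y hx hy => simp [hx, hy]
  | hs c x hx => simp [hx]

open scoped ComplexOrder in
theorem gramProd_posSemidef {n : ℕ} (f : Fin n → ∀ i, E i) (s : Finset ι) :
    (Matrix.of fun k l => ∏ i ∈ s, ⟪f k i, f l i⟫ : Matrix (Fin n) (Fin n) ℂ).PosSemidef := by
  classical
  induction s using Finset.induction_on with
  | empty =>
    have := Matrix.posSemidef_gram ℂ (fun _ : Fin n => (1 : ℂ))
    refine (congrArg Matrix.PosSemidef ?_).mp this
    ext k l
    simp [Matrix.gram]
  | insert a s ha ih =>
    have := (Matrix.posSemidef_gram ℂ (fun k : Fin n => f k a)).hadamard ih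
    refine (congrArg Matrix.PosSemidef ?_).mp this
    ext k l
    simp [Matrix.gram, Finset.prod_insert ha]

theorem tensorForm_nonneg (z : AlgTensor E) : 0 ≤ (tensorForm z z).re := by
  have hz : z ∈ Submodule.span ℂ (Set.range (AlgTensor.pure (E := E))) := by
    rw [AlgTensor.span_pure]; trivial
  obtain ⟨n, c, f, rfl⟩ := Submodule.mem_span_set'.1 hz
  choose g hg using fun k => (f k).2
  have h := (gramProd_posSemidef g Finset.univ).re_dotProduct_nonneg c
  refine h.trans_eq (congrArg Complex.re ?_)
  simp only [← hg, map_sum, LinearMap.sum_apply, LinearMap.smul_apply,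
    LinearMap.map_smulₛₗ, tensorForm_pure, dotProduct, Matrix.mulVec, Pi.star_apply,
    Matrix.of_apply, smul_eq_mul, Finset.mul_sum]
  refine Finset.sum_congr rfl fun k _ => Finset.sum_congr rfl fun l _ => ?_
  simp only [starRingEnd_apply, RingHom.id_apply]
  ring

/-- The (semi-)inner product with `⟪⨂ᵢ fᵢ, ⨂ᵢ gᵢ⟫ = ∏ᵢ ⟪fᵢ, gᵢ⟫`. -/
abbrev tensorCore : PreInnerProductSpace.Core ℂ (AlgTensor E) where
  inner w z := tensorForm z w
  conj_inner_symm w z := tensorForm_conj w z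
  re_inner_nonneg z := tensorForm_nonneg z
  add_left x y z := by simp
  smul_left x y c := by simp

instance : SeminormedAddCommGroup (AlgTensor E) :=
  InnerProductSpace.Core.toSeminormedAddCommGroup (c := tensorCore (E := E))

instance : InnerProductSpace ℂ (AlgTensor E) := InnerProductSpace.ofCore (tensorCore (E := E))

theorem inner_pure (f g : ∀ i, E i) :
    ⟪AlgTensor.pure f, AlgTensor.pure g⟫ = ∏ i, ⟪f i, g i⟫ := tensorForm_pure g f

variable (E)

/-- The Hilbert space tensor product `⨂ᵢ Eᵢ`: the completion of the algebraic one. -/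
def HilbertTensor : Type (max u v) := UniformSpace.Completion (AlgTensor E)

instance : NormedAddCommGroup (HilbertTensor E) :=
  inferInstanceAs (NormedAddCommGroup (UniformSpace.Completion (AlgTensor E)))
instance : InnerProductSpace ℂ (HilbertTensor E) :=
  inferInstanceAs (InnerProductSpace ℂ (UniformSpace.Completion (AlgTensor E)))
instance : CompleteSpace (HilbertTensor E) :=
  inferInstanceAs (CompleteSpace (UniformSpace.Completion (AlgTensor E)))

/-- The canonical isometry from the algebraic tensor product, with dense range. -/
def ofAlg : AlgTensor E →ₗᵢ[ℂ] HilbertTensor E :=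
  UniformSpace.Completion.toComplₗᵢ (𝕜 := ℂ) (E := AlgTensor E)

theorem denseRange_ofAlg : DenseRange (ofAlg E) :=
  UniformSpace.Completion.denseRange_coe (α := AlgTensor E)

end HilbertTensor

/-! ### Local Hilbert spaces and local algebras -/

section Local

variable {Γ : Type*} (H : Γ → Type*)
  [∀ x, NormedAddCommGroup (H x)] [∀ x, InnerProductSpace ℂ (H x)]

/-- `𝓗_Λ = ⨂_{x ∈ Λ} 𝓗_x`. -/
abbrev LocalSpace (Λ : Finset Γ) : Type _ := HilbertTensor fun x : Λ => H x

/-- `𝓐_Λ = 𝓑(𝓗_Λ)`, the bounded operators on `𝓗_Λ`. -/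
abbrev LocalAlgebra (Λ : Finset Γ) : Type _ := LocalSpace H Λ →L[ℂ] LocalSpace H Λ

variable {H} in
/-- The vector `⨂_{x ∈ Λ} f_x` of `𝓗_Λ`. -/
def pureTensor {Λ : Finset Γ} (f : ∀ x : Λ, H x) : LocalSpace H Λ :=
  ofAlg _ (AlgTensor.pure f)

theorem inner_pureTensor {Λ : Finset Γ} (f g : ∀ x : Λ, H x) :
    ⟪pureTensor f, pureTensor g⟫ = ∏ x, ⟪f x, g x⟫ := by
  rw [pureTensor, pureTensor, LinearIsometry.inner_map_map, inner_pure]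

/-- The Hilbert space tensor product `𝓗_X ⊗ 𝓗_Y`. -/
abbrev PairSpace (X Y : Finset Γ) : Type _ :=
  UniformSpace.Completion (LocalSpace H X ⊗[ℂ] LocalSpace H Y)

variable {H}

/-- The restriction of a family indexed by `Λ` to a subset `X`. -/
def restr {X Λ : Finset Γ} (h : X ⊆ Λ) (f : ∀ x : Λ, H x) : ∀ x : X, H x :=
  fun x => f ⟨x.1, h x.2⟩

theorem restr_update_mem {X Λ : Finset Γ} [DecidableEq X] [DecidableEq Λ] (h : X ⊆ Λ) (f : ∀ x : Λ, H x)
    (i : Λ) (a : H i) (hi : i.1 ∈ X) :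
    restr h (Function.update f i a) = Function.update (restr h f) ⟨i.1, hi⟩ a := by
  ext x
  by_cases hx : x = ⟨i.1, hi⟩
  · subst hx; simp [restr]
  · have : (⟨x.1, h x.2⟩ : Λ) ≠ i := fun e => hx (by subst e; rfl)
    simp [restr, Function.update_of_ne hx, Function.update_of_ne this]

theorem restr_update_notMem {X Λ : Finset Γ} [DecidableEq Λ] (h : X ⊆ Λ) (f : ∀ x : Λ, H x)
    (i : Λ) (a : H i) (hi : i.1 ∉ X) : restr h (Function.update f i a) = restr h f := by
  ext x
  have : (⟨x.1, h x.2⟩ : Λ) ≠ i := fun e => hi (congrArg Subtype.val e ▸ x.2)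
  simp [restr, Function.update_of_ne this]

theorem pureTensor_update_add {Λ : Finset Γ} [DecidableEq Λ] (f : ∀ x : Λ, H x)
    (i : Λ) (a b : H i) : pureTensor (Function.update f i (a + b)) =
      pureTensor (Function.update f i a) + pureTensor (Function.update f i b) := by
  have : (AlgTensor.pure (Function.update f i (a + b)) : AlgTensor fun x : Λ => H x) =
      AlgTensor.pure (Function.update f i a) + AlgTensor.pure (Function.update f i b) :=
    (PiTensorProduct.tprod ℂ).map_update_add f i a b
  rw [pureTensor, this, map_add]; rfl

theorem pureTensor_update_smul {Λ : Finset Γ} [DecidableEq Λ] (f : ∀ x : Λ, H x)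
    (i : Λ) (c : ℂ) (a : H i) : pureTensor (Function.update f i (c • a)) =
      c • pureTensor (Function.update f i a) := by
  have : (AlgTensor.pure (Function.update f i (c • a)) : AlgTensor fun x : Λ => H x) =
      c • AlgTensor.pure (Function.update f i a) :=
    (PiTensorProduct.tprod ℂ).map_update_smul f i c a
  rw [pureTensor, this, map_smul]; rfl

/-- `f ↦ (⨂_{x ∈ X} f_x) ⊗ (⨂_{x ∈ Λ \ X} f_x)` as a multilinear map. -/
def splitMultilinear [DecidableEq Γ] {X Λ : Finset Γ} (h : X ⊆ Λ) :
    MultilinearMap ℂ (fun x : Λ => H x) (LocalSpace H X ⊗[ℂ] LocalSpace H (Λ \ X)) where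
  toFun f := pureTensor (restr h f) ⊗ₜ[ℂ] pureTensor (restr Finset.sdiff_subset f)
  map_update_add' f i x y := by
    by_cases hi : i.1 ∈ X
    · have hi' : i.1 ∉ Λ \ X := fun e => (Finset.mem_sdiff.1 e).2 hi
      simp only [restr_update_mem h _ _ _ hi, restr_update_notMem _ _ _ _ hi',
        pureTensor_update_add, TensorProduct.add_tmul]
    · have hi' : i.1 ∈ Λ \ X := Finset.mem_sdiff.2 ⟨i.2, hi⟩
      simp only [restr_update_notMem h _ _ _ hi, restr_update_mem _ _ _ _ hi',
        pureTensor_update_add, TensorProduct.tmul_add]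
  map_update_smul' f i c x := by
    by_cases hi : i.1 ∈ X
    · have hi' : i.1 ∉ Λ \ X := fun e => (Finset.mem_sdiff.1 e).2 hi
      simp only [restr_update_mem h _ _ _ hi, restr_update_notMem _ _ _ _ hi',
        pureTensor_update_smul, TensorProduct.smul_tmul']
    · have hi' : i.1 ∈ Λ \ X := Finset.mem_sdiff.2 ⟨i.2, hi⟩
      simp only [restr_update_notMem h _ _ _ hi, restr_update_mem _ _ _ _ hi',
        pureTensor_update_smul, TensorProduct.tmul_smul]

/-- The map `⨂_{x ∈ Λ} f_x ↦ (⨂_{x ∈ X} f_x) ⊗ (⨂_{x ∈ Λ \ X} f_x)`. -/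
def splitAlg [DecidableEq Γ] {X Λ : Finset Γ} (h : X ⊆ Λ) :
    AlgTensor (fun x : Λ => H x) →ₗ[ℂ] LocalSpace H X ⊗[ℂ] LocalSpace H (Λ \ X) :=
  PiTensorProduct.lift (splitMultilinear h)

theorem splitAlg_pure [DecidableEq Γ] {X Λ : Finset Γ} (h : X ⊆ Λ) (f : ∀ x : Λ, H x) :
    splitAlg h (AlgTensor.pure f) =
      pureTensor (restr h f) ⊗ₜ[ℂ] pureTensor (restr Finset.sdiff_subset f) :=
  PiTensorProduct.lift.tprod _

theorem inner_splitAlg [DecidableEq Γ] {X Λ : Finset Γ} (h : X ⊆ Λ)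
    (z w : AlgTensor (fun x : Λ => H x)) : ⟪splitAlg h z, splitAlg h w⟫ = ⟪z, w⟫ := by
  induction z using AlgTensor.induction with
  | h0 => simp
  | hp f =>
    induction w using AlgTensor.induction with
    | h0 => simp
    | hp g =>
      simp only [splitAlg_pure, TensorProduct.inner_tmul, inner_pureTensor, inner_pure]
      let φ : Γ → ℂ := fun x => if hx : x ∈ Λ then ⟪f ⟨x, hx⟩, g ⟨x, hx⟩⟫ else 1
      have hφ : ∀ {Y : Finset Γ} (hY : Y ⊆ Λ),
          ∏ x : Y, ⟪restr hY f x, restr hY g x⟫ = ∏ x ∈ Y, φ x := by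
        intro Y hY
        rw [← Finset.prod_coe_sort Y φ]
        refine Finset.prod_congr rfl fun x _ => ?_
        simp [φ, restr, hY x.2]
      have h1 := hφ h
      have h2 := hφ (Finset.sdiff_subset (s := Λ) (t := X))
      have h3 := hφ (Finset.Subset.refl Λ)
      rw [h1, h2, mul_comm, Finset.prod_sdiff h, ← h3]
      rfl
    | ha x y hx hy => simp [inner_add_right, hx, hy]
    | hs c x hx =>
      rw [LinearMap.map_smul, inner_smul_right, hx, inner_smul_right]
  | ha x y hx hy => simp [inner_add_left, hx, hy]
  | hs c x hx =>
    rw [LinearMap.map_smul, inner_smul_left, hx, inner_smul_left]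

/-- `splitAlg` as a linear isometry. -/
def splitIsometry [DecidableEq Γ] {X Λ : Finset Γ} (h : X ⊆ Λ) :
    AlgTensor (fun x : Λ => H x) →ₗᵢ[ℂ] LocalSpace H X ⊗[ℂ] LocalSpace H (Λ \ X) where
  toLinearMap := splitAlg h
  norm_map' z := by
    rw [@norm_eq_sqrt_re_inner ℂ, @norm_eq_sqrt_re_inner ℂ, inner_splitAlg]

/-- The canonical unitary `𝓗_Λ → 𝓗_X ⊗ 𝓗_{Λ \ X}`, for `X ⊆ Λ`: the continuous extension of
`splitAlg`. -/
def split [DecidableEq Γ] {X Λ : Finset Γ} (h : X ⊆ Λ) :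
    LocalSpace H Λ →L[ℂ] PairSpace H X (Λ \ X) :=
  (UniformSpace.Completion.toComplL.comp
    (splitIsometry h).toContinuousLinearMap).fromCompletion

theorem split_pureTensor [DecidableEq Γ] {X Λ : Finset Γ} (h : X ⊆ Λ) (f : ∀ x : Λ, H x) :
    split h (pureTensor f) =
      ((pureTensor (restr h f) ⊗ₜ[ℂ] pureTensor (restr Finset.sdiff_subset f) :
        LocalSpace H X ⊗[ℂ] LocalSpace H (Λ \ X)) : PairSpace H X (Λ \ X)) := by
  rw [← splitAlg_pure]
  exact ContinuousLinearMap.fromCompletion_apply_coe _ _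

/-- The embedding `𝓐_X ⊆ 𝓐_Λ` for `X ⊆ Λ`: the operator `A ⊗ 𝟙_{Λ \ X}`, with
`𝓗_X ⊗ 𝓗_{Λ \ X}` identified with `𝓗_Λ` by the canonical unitary. -/
def embed [DecidableEq Γ] {X Λ : Finset Γ} (h : X ⊆ Λ) (A : LocalAlgebra H X) :
    LocalAlgebra H Λ :=
  (split h).adjoint ∘L
    (TensorProduct.mapL A (ContinuousLinearMap.id ℂ (LocalSpace H (Λ \ X)))).completion ∘L split h

/-- The matrix elements of `embed h A` between pure tensors are those of `A ⊗ 𝟙`. -/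
theorem inner_embed_pureTensor [DecidableEq Γ] {X Λ : Finset Γ} (h : X ⊆ Λ)
    (A : LocalAlgebra H X) (f g : ∀ x : Λ, H x) :
    ⟪pureTensor f, embed h A (pureTensor g)⟫ =
      ⟪pureTensor (restr h f), A (pureTensor (restr h g))⟫ *
        ∏ y : (Λ \ X : Finset Γ), ⟪f ⟨y, Finset.sdiff_subset y.2⟩,
          g ⟨y, Finset.sdiff_subset y.2⟩⟫ := by
  simp only [embed, ContinuousLinearMap.comp_apply, ContinuousLinearMap.adjoint_inner_right,
    split_pureTensor]
  rw [ContinuousLinearMap.completion_apply_coe, UniformSpace.Completion.inner_coe,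
    TensorProduct.mapL_tmul, TensorProduct.inner_tmul]
  simp only [ContinuousLinearMap.id_apply, inner_pureTensor]
  rfl

end Local

/-! ### Interactions, decay functions and the Heisenberg dynamics -/

section Dynamics

variable {Γ : Type*} [MetricSpace Γ]

/-- `‖F‖ = sup_x ∑_y F(d(x,y))`, with values in `[0, ∞]`. -/
def uniformSum (Γ : Type*) [MetricSpace Γ] (F : ℝ → ℝ) : ℝ≥0∞ :=
  ⨆ x : Γ, ∑' y : Γ, ENNReal.ofReal (F (dist x y))

/-- The convolution condition `∑_z F(d(x,z)) F(d(z,y)) ≤ C F(d(x,y))` for all `x`, `y`. -/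
def ConvolutionCondition (Γ : Type*) [MetricSpace Γ] (F : ℝ → ℝ) (C : ℝ) : Prop :=
  ∀ x y : Γ, ∑' z : Γ, ENNReal.ofReal (F (dist x z) * F (dist z y)) ≤
    ENNReal.ofReal (C * F (dist x y))

/-- The distance `inf {d(x,y) : x ∈ X, y ∈ Y}` of two finite sets (`∞` if one is empty). -/
def setDist (X Y : Finset Γ) : ℝ≥0∞ := ⨅ x ∈ X, ⨅ y ∈ Y, edist x y

variable {H : Γ → Type*} [∀ x, NormedAddCommGroup (H x)] [∀ x, InnerProductSpace ℂ (H x)]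

/-- `‖Φ‖_F = sup_{x,y} F(d(x,y))⁻¹ ∑_{Z ∋ x,y} sup_{0 ≤ t ≤ 1} ‖Φ_Z(t)‖`, with values in
`[0, ∞]`; the sum is over the finite sets `Z` that contain `x` and `y`. -/
def interactionNorm (F : ℝ → ℝ) (Φ : (Z : Finset Γ) → ℝ → LocalAlgebra H Z) : ℝ≥0∞ :=
  ⨆ (x : Γ) (y : Γ),
    (∑' Z : {Z : Finset Γ // x ∈ Z ∧ y ∈ Z}, ⨆ t ∈ Set.Icc (0 : ℝ) 1, ‖Φ Z t‖ₑ) /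
      ENNReal.ofReal (F (dist x y))

variable [DecidableEq Γ]

/-- The local Hamiltonian `H_Λ(t) = ∑_{Z ⊆ Λ} Φ_Z(t)`. -/
def hamiltonian (Φ : (Z : Finset Γ) → ℝ → LocalAlgebra H Z) (Λ : Finset Γ) (t : ℝ) :
    LocalAlgebra H Λ :=
  ∑ Z ∈ Λ.powerset.attach, embed (Finset.mem_powerset.1 Z.2) (Φ Z t)

/-- `U` is the family of unitary propagators of `H_Λ` on `[0,1]`: in the strong sense,
`d/dt U(t,s) = -i H_Λ(t) U(t,s)` and `U(s,s) = 𝟙`. -/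
structure IsPropagator (Φ : (Z : Finset Γ) → ℝ → LocalAlgebra H Z) (Λ : Finset Γ)
    (U : ℝ → ℝ → LocalAlgebra H Λ) : Prop where
  unitary : ∀ t ∈ Set.Icc (0 : ℝ) 1, ∀ s ∈ Set.Icc (0 : ℝ) 1, U t s ∈ unitary (LocalAlgebra H Λ)
  refl : ∀ s ∈ Set.Icc (0 : ℝ) 1, U s s = 1
  deriv : ∀ s ∈ Set.Icc (0 : ℝ) 1, ∀ ψ : LocalSpace H Λ, ∀ t ∈ Set.Icc (0 : ℝ) 1,
    HasDerivWithinAt (fun r => U r s ψ) (-(Complex.I • hamiltonian Φ Λ t (U t s ψ)))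
      (Set.Icc 0 1) t

/-- The Heisenberg dynamics `τ_t^Λ(A) = U(t,0)* A U(t,0)` given by the propagators `U`. -/
def heisenberg {Λ : Finset Γ} (U : ℝ → ℝ → LocalAlgebra H Λ) (t : ℝ) (A : LocalAlgebra H Λ) :
    LocalAlgebra H Λ :=
  star (U t 0) * A * U t 0

open Classical in
/-- The function `g` of the Lieb-Robinson bound, with `N` in place of `‖Φ‖_F`:
`C g(t) = exp(2 N C |t|) - 1` if `d(X,Y) > 0`, and `F(0) g(t) = exp(2 N C |t|)` otherwise. -/
def growth (F : ℝ → ℝ) (C N : ℝ) (X Y : Finset Γ) (t : ℝ) : ℝ :=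
  if 0 < setDist X Y then (Real.exp (2 * N * C * |t|) - 1) / C
  else Real.exp (2 * N * C * |t|) / F 0

end Dynamics

end QLattice

end

noncomputable section

set_option linter.unusedSectionVars false

namespace QLattice

/-! ### Local operators in the larger algebra -/

section Embedding

variable {Γ : Type*} {H : Γ → Type*}
  [∀ x, NormedAddCommGroup (H x)] [∀ x, InnerProductSpace ℂ (H x)]

/-! Fix `B` and let c_X(s) be the best constant in ‖[τ_s(A), B]‖ ≤ c‖A‖ over A ∈ 𝓐_X. During a short
time h, only the terms Φ_Z with Z ∩ X ≠ ∅ move A to first order, since the others commute with A.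
With J equal to i times their time integral, T = τ_s(A) and L = τ_s(J), one has τ_{s+h}(A) ≈ T +
[L,T], and the Jacobi identity gives [τ_{s+h}(A), B] ≈ ([T,B] + [L,[T,B]]) - [T,[L,B]]. As L is
skew-adjoint, the bracketed part is [T,B] conjugated by a unitary up to O(h²), so its norm does not
grow to first order (`norm_add_lie_le`). The last term is at most 2‖A‖ ∑ h b_Z c_Z(s), where b_Z
bounds ‖Φ_Z‖. Formally, c_X' ≤ 2 ∑_{Z ∩ X ≠ ∅} b_Z c_Z, a finite linear system with nonnegative
coefficients (`norm_lie_conj_le`, `exists_step`).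

Rather than being iterated into a series, the system is compared (`norm_lie_le_supersolution`) with
the explicit supersolution w_Z(s) = 2‖B‖(1_{Z ∩ Y ≠ ∅} + q(s) ∑_{z ∈ Z, y ∈ Y} F(d(z,y))), where q'
= 2N(1 + Cq), q(0) = 0 and N = ‖Φ‖_F. The convolution condition makes it one (`sum_interaction_le`).
For disjoint X and Y, w_X(t) is the claimed bound; for overlapping sets the trivial bound suffices.

The Hamiltonian is only strongly continuous, so the commutator need not be norm differentiable.
Differential inequalities are therefore replaced by Euler steps with uniform O(h²) errors. The
integral of Φ_Z over a step is taken strongly and stays in 𝓐_Z, so the recursion closes. -/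

theorem dense_span_pureTensor (Λ : Finset Γ) :
    Dense (Submodule.span ℂ (Set.range (pureTensor (H := H) (Λ := Λ))) :
      Set (LocalSpace H Λ)) := by
  refine (denseRange_ofAlg fun x : Λ => H x).mono ?_
  rintro _ ⟨z, rfl⟩
  induction z using AlgTensor.induction with
  | h0 => rw [map_zero]; exact Submodule.zero_mem _
  | hp f => exact Submodule.subset_span ⟨f, rfl⟩
  | ha x y hx hy => rw [map_add]; exact Submodule.add_mem _ hx hy
  | hs c x hx => rw [map_smul]; exact Submodule.smul_mem _ c hx

theorem ext_pureTensor {Λ : Finset Γ} {G : Type*} [NormedAddCommGroup G] [NormedSpace ℂ G]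
    {S T : LocalSpace H Λ →L[ℂ] G} (h : ∀ f, S (pureTensor f) = T (pureTensor f)) : S = T :=
  ContinuousLinearMap.ext_on (dense_span_pureTensor Λ) (by rintro _ ⟨f, rfl⟩; exact h f)

theorem ext_inner_pureTensor {Λ : Finset Γ} {S T : LocalAlgebra H Λ}
    (h : ∀ f g, ⟪pureTensor f, S (pureTensor g)⟫ = ⟪pureTensor f, T (pureTensor g)⟫) :
    S = T := by
  refine ext_pureTensor fun g => ext_inner_left ℂ fun v => ?_
  have : (innerSL ℂ (S (pureTensor g)) : LocalSpace H Λ →L[ℂ] ℂ) =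
      innerSL ℂ (T (pureTensor g)) := by
    refine ext_pureTensor fun f => ?_
    rw [innerSL_apply_apply, innerSL_apply_apply, ← inner_conj_symm, h, inner_conj_symm]
  have h' := congrArg (fun φ : LocalSpace H Λ →L[ℂ] ℂ => φ v) this
  simp only [innerSL_apply_apply] at h'
  rw [← inner_conj_symm, h', inner_conj_symm]

variable [DecidableEq Γ]

theorem inner_split_pureTensor {X Λ : Finset Γ} (h : X ⊆ Λ) (f g : ∀ x : Λ, H x) :
    ⟪split h (pureTensor f), split h (pureTensor g)⟫ = ⟪pureTensor f, pureTensor g⟫ := by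
  rw [split_pureTensor, split_pureTensor, UniformSpace.Completion.inner_coe, ← splitAlg_pure,
    ← splitAlg_pure, inner_splitAlg, pureTensor, pureTensor, LinearIsometry.inner_map_map]

/-- The isometry property of `split` is all that the later arguments need; its surjectivity plays no
role. -/
theorem adjoint_split_comp_split {X Λ : Finset Γ} (h : X ⊆ Λ) :
    (split (H := H) h).adjoint ∘L split h = 1 :=
  ext_inner_pureTensor fun f g => by
    rw [ContinuousLinearMap.comp_apply, ContinuousLinearMap.adjoint_inner_right,
      inner_split_pureTensor]
    rfl

theorem norm_split_apply {X Λ : Finset Γ} (h : X ⊆ Λ) (v : LocalSpace H Λ) :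
    ‖split h v‖ = ‖v‖ := by
  have h1 : (split (H := H) h).adjoint (split h v) = v :=
    congrArg (fun T : LocalAlgebra H Λ => T v) (adjoint_split_comp_split h)
  rw [@norm_eq_sqrt_re_inner ℂ, @norm_eq_sqrt_re_inner ℂ,
    ← ContinuousLinearMap.adjoint_inner_right, h1]

theorem norm_completion_apply_le {E G : Type*} [SeminormedAddCommGroup E] [NormedSpace ℂ E]
    [SeminormedAddCommGroup G] [NormedSpace ℂ G] (T : E →L[ℂ] G)
    (v : UniformSpace.Completion E) : ‖T.completion v‖ ≤ ‖T‖ * ‖v‖ := by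
  induction v using UniformSpace.Completion.induction_on with
  | hp => exact isClosed_le (by fun_prop) (by fun_prop)
  | ih a =>
    rw [ContinuousLinearMap.completion_apply_coe, UniformSpace.Completion.norm_coe,
      UniformSpace.Completion.norm_coe]
    exact T.le_opNorm a

theorem norm_embed_le {X Λ : Finset Γ} (h : X ⊆ Λ) (A : LocalAlgebra H X) :
    ‖embed h A‖ ≤ ‖A‖ := by
  have hs : ‖split (H := H) h‖ ≤ 1 :=
    ContinuousLinearMap.opNorm_le_bound _ zero_le_one fun v => by
      rw [norm_split_apply, one_mul]
  refine ContinuousLinearMap.opNorm_le_bound _ (norm_nonneg _) fun v => ?_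
  refine (ContinuousLinearMap.le_opNorm (split h).adjoint _).trans ?_
  rw [LinearIsometryEquiv.norm_map]
  refine (mul_le_of_le_one_left (norm_nonneg _) hs).trans ?_
  refine (norm_completion_apply_le _ (split h v)).trans ?_
  rw [norm_split_apply]
  refine mul_le_mul_of_nonneg_right ?_ (norm_nonneg _)
  refine (TensorProduct.norm_mapL_le _ _).trans ?_
  exact mul_le_of_le_one_right (norm_nonneg _) ContinuousLinearMap.norm_id_le

/-- The vector `v ⊗ (⨂_{x ∈ Λ \ X} g_x)` of `𝓗_Λ`, as a function of `v ∈ 𝓗_X`. -/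
def slot {X Λ : Finset Γ} (h : X ⊆ Λ) (g : ∀ x : Λ, H x) :
    LocalSpace H X →L[ℂ] LocalSpace H Λ :=
  (split h).adjoint ∘L UniformSpace.Completion.toComplL ∘L
    (TensorProduct.mkL ℂ (LocalSpace H X) (LocalSpace H (Λ \ X))).flip
      (pureTensor (restr Finset.sdiff_subset g))

theorem embed_pureTensor {X Λ : Finset Γ} (h : X ⊆ Λ) (A : LocalAlgebra H X)
    (g : ∀ x : Λ, H x) :
    embed h A (pureTensor g) = slot h g (A (pureTensor (restr h g))) := by
  simp only [embed, ContinuousLinearMap.comp_apply, split_pureTensor]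
  rw [ContinuousLinearMap.completion_apply_coe, TensorProduct.mapL_tmul]
  rfl

/-- The family that agrees with `p` on `X` and with `g` outside `X`. -/
def glue {X Λ : Finset Γ} (p : ∀ x : X, H x) (g : ∀ x : Λ, H x) : ∀ x : Λ, H x :=
  fun x => if hx : x.1 ∈ X then p ⟨x.1, hx⟩ else g x

theorem glue_of_mem {X Λ : Finset Γ} (p : ∀ x : X, H x) (g : ∀ x : Λ, H x) {x : Λ}
    (hx : x.1 ∈ X) : glue p g x = p ⟨x.1, hx⟩ := dif_pos hx

theorem glue_of_notMem {X Λ : Finset Γ} (p : ∀ x : X, H x) (g : ∀ x : Λ, H x) {x : Λ}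
    (hx : x.1 ∉ X) : glue p g x = g x := dif_neg hx

theorem restr_glue {X Λ : Finset Γ} (h : X ⊆ Λ) (p : ∀ x : X, H x) (g : ∀ x : Λ, H x) :
    restr h (glue p g) = p := funext fun x => glue_of_mem p g x.2

theorem restr_glue_of_disjoint {X Z Λ : Finset Γ} (h : Z ⊆ Λ) (hd : Disjoint X Z)
    (p : ∀ x : X, H x) (g : ∀ x : Λ, H x) : restr h (glue p g) = restr h g :=
  funext fun x => glue_of_notMem (x := ⟨x.1, h x.2⟩) p g (Finset.disjoint_right.1 hd x.2)

theorem slot_pureTensor {X Λ : Finset Γ} (h : X ⊆ Λ) (p : ∀ x : X, H x) (g : ∀ x : Λ, H x) :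
    slot h g (pureTensor p) = pureTensor (glue p g) := by
  have h1 : split h (pureTensor (glue p g)) = ((pureTensor p ⊗ₜ[ℂ]
      pureTensor (restr Finset.sdiff_subset g) : LocalSpace H X ⊗[ℂ] LocalSpace H (Λ \ X)) :
        PairSpace H X (Λ \ X)) := by
    rw [split_pureTensor, restr_glue, restr_glue_of_disjoint _ Finset.disjoint_sdiff]
  have h2 : (split (H := H) h).adjoint (split h (pureTensor (glue p g))) =
      pureTensor (glue p g) :=
    congrArg (fun T : LocalAlgebra H Λ => T (pureTensor (glue p g)))
      (adjoint_split_comp_split h)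
  rw [h1] at h2
  exact h2

theorem star_embed {X Λ : Finset Γ} (h : X ⊆ Λ) (A : LocalAlgebra H X) :
    star (embed h A) = embed h (star A) :=
  ext_inner_pureTensor fun f g => by
    rw [ContinuousLinearMap.star_eq_adjoint, ContinuousLinearMap.star_eq_adjoint,
      ContinuousLinearMap.adjoint_inner_right, ← inner_conj_symm, inner_embed_pureTensor,
      inner_embed_pureTensor, map_mul, inner_conj_symm, map_prod,
      ContinuousLinearMap.adjoint_inner_right]
    simp only [inner_conj_symm]

theorem embed_refl {Λ : Finset Γ} (h : Λ ⊆ Λ) (A : LocalAlgebra H Λ) : embed h A = A :=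
  ext_inner_pureTensor fun f g => by
    have : IsEmpty (Λ \ Λ : Finset Γ) := ⟨fun y => by simpa using y.2⟩
    rw [inner_embed_pureTensor, Fintype.prod_empty, mul_one]
    rfl

/-- An operator on 𝓗_Z sends a pure tensor to a general vector `v`, so commutation cannot be tested
on pure tensors alone. Both sides are continuous and linear in `v`, which reduces the formula to
pure `v`. -/
theorem inner_embed_slot {X Z Λ : Finset Γ} (hX : X ⊆ Λ) (hZ : Z ⊆ Λ) (hd : Disjoint X Z)
    (A : LocalAlgebra H X) (f g : ∀ x : Λ, H x) (v : LocalSpace H Z) :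
    ⟪pureTensor f, embed hX A (slot hZ g v)⟫ =
      ⟪pureTensor (restr hX f), A (pureTensor (restr hX g))⟫ *
        (∏ y : (Λ \ (X ∪ Z) : Finset Γ), ⟪f ⟨y, Finset.sdiff_subset y.2⟩,
          g ⟨y, Finset.sdiff_subset y.2⟩⟫) * ⟪pureTensor (restr hZ f), v⟫ := by
  set c : ℂ := ⟪pureTensor (restr hX f), A (pureTensor (restr hX g))⟫ *
        ∏ y : (Λ \ (X ∪ Z) : Finset Γ), ⟪f ⟨y, Finset.sdiff_subset y.2⟩,
          g ⟨y, Finset.sdiff_subset y.2⟩⟫ with hc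
  have : innerSL ℂ (pureTensor f) ∘L embed hX A ∘L slot hZ g =
      c • innerSL ℂ (pureTensor (restr hZ f)) := by
    refine ext_pureTensor fun p => ?_
    simp only [ContinuousLinearMap.comp_apply, smul_apply,
      innerSL_apply_apply, slot_pureTensor, inner_embed_pureTensor, inner_pureTensor, smul_eq_mul]
    rw [restr_glue_of_disjoint hX hd.symm, hc, mul_assoc]
    congr 1
    -- Extending the factors by 1 to all of Γ turns products over different subtypes into products
    -- of one function over Λ \ X = (Λ \ (X ∪ Z)) ∪ Z.
    let φ : Γ → ℂ := fun x => if hx : x ∈ Λ then ⟪f ⟨x, hx⟩, glue p g ⟨x, hx⟩⟫ else 1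
    have e1 : ∀ (S : Finset Γ) (hS : S ⊆ Λ),
        ∏ y : S, ⟪f ⟨y, hS y.2⟩, glue p g ⟨y, hS y.2⟩⟫ = ∏ y ∈ S, φ y := fun S hS => by
      rw [← Finset.prod_coe_sort S φ]
      refine Finset.prod_congr rfl fun y _ => ?_
      simp [φ, hS y.2]
    have e2 : ∏ y : (Λ \ (X ∪ Z) : Finset Γ), ⟪f ⟨y, Finset.sdiff_subset y.2⟩,
          g ⟨y, Finset.sdiff_subset y.2⟩⟫ = ∏ y ∈ Λ \ (X ∪ Z), φ y := by
      rw [← e1 _ Finset.sdiff_subset]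
      refine Finset.prod_congr rfl fun y _ => ?_
      rw [glue_of_notMem]
      exact fun hy => (Finset.mem_sdiff.1 y.2).2 (Finset.mem_union_right _ hy)
    have e3 : ∏ y : Z, ⟪restr hZ f y, p y⟫ = ∏ y ∈ Z, φ y := by
      rw [← e1 _ hZ]
      refine Finset.prod_congr rfl fun y _ => ?_
      rw [glue_of_mem (x := ⟨y.1, hZ y.2⟩) p g y.2]
      rfl
    rw [e1 _ Finset.sdiff_subset, e2, e3, ← Finset.prod_union]
    · refine Finset.prod_congr ?_ fun _ _ => rfl
      ext x
      have h1 := @hZ x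
      have h2 := Finset.disjoint_right.1 hd 
      specialize @h2 x
      simp only [Finset.mem_union, Finset.mem_sdiff]
      tauto
    · refine Finset.disjoint_left.2 fun x hx hx' => ?_
      exact (Finset.mem_sdiff.1 hx).2 (Finset.mem_union_right _ hx')
  exact DFunLike.congr_fun this v

/-- In either order the matrix element factorizes into contributions of X, Z and the remaining
sites. -/
theorem commute_embed {X Z Λ : Finset Γ} (hX : X ⊆ Λ) (hZ : Z ⊆ Λ) (hd : Disjoint X Z)
    (A : LocalAlgebra H X) (B : LocalAlgebra H Z) : Commute (embed hX A) (embed hZ B) :=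
  ext_inner_pureTensor fun f g => by
    rw [mul_apply_eq_comp, mul_apply_eq_comp, embed_pureTensor hZ,
      embed_pureTensor hX, inner_embed_slot hX hZ hd, inner_embed_slot hZ hX hd.symm,
      Finset.union_comm Z X]
    ring

end Embedding

/-! ### Strongly continuous families of operators -/

section Strong

variable {E : Type*} [NormedAddCommGroup E] [NormedSpace ℂ E] [CompleteSpace E]

/-- Continuity in the strong operator topology. -/
def StrongContinuous (T : ℝ → E →L[ℂ] E) : Prop := ∀ v, Continuous fun r => T r v

/-- The integral is taken vector by vector, because `T` need not be continuous in operator norm. -/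
theorem exists_strong_integral {T : ℝ → E →L[ℂ] E} (hT : StrongContinuous T) {M : ℝ}
    (hM : ∀ r, ‖T r‖ ≤ M) {a b : ℝ} (hab : a ≤ b) :
    ∃ K : E →L[ℂ] E, (∀ v, K v = ∫ r in a..b, T r v) ∧ ‖K‖ ≤ (b - a) * M := by
  have hM0 : 0 ≤ M := (norm_nonneg _).trans (hM 0)
  let L : E →ₗ[ℂ] E :=
    { toFun := fun v => ∫ r in a..b, T r v
      map_add' := fun v w => by
        simp only [map_add]
        exact intervalIntegral.integral_add ((hT v).intervalIntegrable _ _)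
          ((hT w).intervalIntegrable _ _)
      map_smul' := fun c v => by
        simp only [map_smul, RingHom.id_apply]
        exact intervalIntegral.integral_smul c _ }
  have hL : ∀ v, ‖L v‖ ≤ (b - a) * M * ‖v‖ := fun v => by
    have := intervalIntegral.norm_integral_le_of_norm_le_const (a := a) (b := b)
      (f := fun r => T r v) (C := M * ‖v‖) fun r _ => (T r).le_of_opNorm_le (hM r) v
    rw [abs_of_nonneg (sub_nonneg.2 hab)] at this
    exact this.trans_eq (by ring)
  exact ⟨L.mkContinuous _ hL, fun v => rfl, LinearMap.mkContinuous_norm_le _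
    (mul_nonneg (sub_nonneg.2 hab) hM0) _⟩

theorem StrongContinuous.exists_norm_le {T : ℝ → E →L[ℂ] E} (hT : StrongContinuous T)
    (hclamp : ∀ r, T r = T (Set.projIcc (0 : ℝ) 1 zero_le_one r)) :
    ∃ M, ∀ r, ‖T r‖ ≤ M := by
  refine banach_steinhaus fun v => ?_
  obtain ⟨M, hM⟩ := (isCompact_Icc (a := (0 : ℝ)) (b := 1)).exists_bound_of_continuousOn
    (hT v).continuousOn
  exact ⟨M, fun r => by rw [hclamp]; exact hM _ (Set.projIcc 0 1 zero_le_one r).2⟩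

theorem strongContinuous_of_dense {T : ℝ → E →L[ℂ] E} {M : ℝ} (hM : ∀ r, ‖T r‖ ≤ M)
    {s : Set E} (hs : Dense s) (h : ∀ v ∈ s, Continuous fun r => T r v) :
    StrongContinuous T := by
  have hM0 : 0 ≤ M := (norm_nonneg _).trans (hM 0)
  refine fun v => continuous_of_uniform_approx_of_continuous fun u hu => ?_
  obtain ⟨ε, hε, hεu⟩ := Metric.mem_uniformity_dist.1 hu
  -- Dividing by M + 1 rather than M covers M = 0.
  obtain ⟨w, hw, hvw⟩ := hs.exists_dist_lt v (div_pos hε (by linarith : 0 < M + 1))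
  refine ⟨fun r => T r w, h w hw, fun r => hεu ?_⟩
  rw [dist_eq_norm, ← map_sub]
  rw [dist_eq_norm, lt_div_iff₀ (by linarith)] at hvw
  refine ((T r).le_of_opNorm_le (hM r) _).trans_lt ?_
  nlinarith [norm_nonneg (v - w)]

/-- Second order estimate for the solutions of `u' = -i H(t) u` with a bounded strongly
continuous generator. -/
theorem norm_propagator_sub_le {T : ℝ → E →L[ℂ] E} (hT : StrongContinuous T) {M : ℝ}
    (hM : ∀ r, ‖T r‖ ≤ M) {V : ℝ → E →L[ℂ] E} {a b : ℝ} (hab : a ≤ b)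
    (hV : ∀ r ∈ Set.Icc a b, ∀ v, ‖V r v‖ ≤ ‖v‖)
    (hd : ∀ v, ∀ r ∈ Set.Icc a b,
      HasDerivWithinAt (fun r => V r v) (-(Complex.I • T r (V r v))) (Set.Icc a b) r)
    {K : E →L[ℂ] E} (hK : ∀ v, K v = ∫ r in a..b, T r v) :
    ‖V b - V a + (Complex.I • K) * V a‖ ≤ (b - a) ^ 2 * M ^ 2 := by
  have hM0 : 0 ≤ M := (norm_nonneg _).trans (hM 0)
  refine ContinuousLinearMap.opNorm_le_bound _ (by positivity) fun v => ?_
  have h1 : ∀ r ∈ Set.Icc a b, ‖V r v - V a v‖ ≤ (b - a) * M * ‖v‖ := fun r hr => by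
    have := norm_image_sub_le_of_norm_deriv_le_segment' (hd v) (C := M * ‖v‖) (fun x hx => by
      rw [norm_neg, norm_smul, Complex.norm_I, one_mul]
      refine ((T x).le_of_opNorm_le (hM x) _).trans ?_
      exact mul_le_mul_of_nonneg_left (hV x ⟨hx.1, hx.2.le⟩ v) hM0) r hr
    refine this.trans ?_
    have h2 : r - a ≤ b - a := by linarith [hr.2]
    calc M * ‖v‖ * (r - a) ≤ M * ‖v‖ * (b - a) := by gcongr
      _ = _ := by ring
  -- The curve corrected by its first-order term has derivative -i T_r(V_r v - V_a v), which `h1`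
  -- makes of order b - a; the mean value inequality supplies the second factor b - a.
  have h2 : ∀ r ∈ Set.Icc a b, HasDerivWithinAt
      (fun r => V r v + Complex.I • ∫ q in a..r, T q (V a v))
      (-(Complex.I • T r (V r v)) + Complex.I • T r (V a v)) (Set.Icc a b) r := fun r hr =>
    (hd v r hr).add
      (((hT (V a v)).integral_hasStrictDerivAt a r).hasDerivAt.hasDerivWithinAt.const_smul
        Complex.I)
  have h3 := norm_image_sub_le_of_norm_deriv_le_segment' h2 (C := (b - a) * M ^ 2 * ‖v‖)
    (fun x hx => by
      rw [neg_add_eq_sub, ← smul_sub, ← map_sub, norm_smul, Complex.norm_I, one_mul]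
      refine ((T x).le_of_opNorm_le (hM x) _).trans ?_
      rw [norm_sub_rev]
      calc M * ‖V x v - V a v‖ ≤ M * ((b - a) * M * ‖v‖) :=
            mul_le_mul_of_nonneg_left (h1 x ⟨hx.1, hx.2.le⟩) hM0
        _ = _ := by ring) b ⟨hab, le_rfl⟩
  simp only [intervalIntegral.integral_same, smul_zero, add_zero, ← hK] at h3
  calc _ = ‖V b v + Complex.I • K (V a v) - V a v‖ := by
        congr 1
        change V b v - V a v + Complex.I • K (V a v) = _
        abel
    _ ≤ _ := h3
    _ = _ := by ring

end Strong

/-! ### Self-adjointness of strong integrals. -/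

section SelfAdjoint

variable {E : Type*} [NormedAddCommGroup E] [InnerProductSpace ℂ E] [CompleteSpace E]

theorem isSelfAdjoint_strong_integral {T : ℝ → E →L[ℂ] E} (hT : StrongContinuous T)
    (hsa : ∀ r, IsSelfAdjoint (T r)) {a b : ℝ} {K : E →L[ℂ] E}
    (hK : ∀ v, K v = ∫ r in a..b, T r v) : IsSelfAdjoint K := by
  rw [ContinuousLinearMap.isSelfAdjoint_iff_isSymmetric]
  intro v w
  change ⟪K v, w⟫ = ⟪v, K w⟫
  have h1 : ∀ v w, ⟪v, K w⟫ = ∫ r in a..b, ⟪v, T r w⟫ := fun v w => by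
    rw [hK]
    exact ((innerSL ℂ v).intervalIntegral_comp_comm ((hT w).intervalIntegrable a b)).symm
  have h2 : (starRingEnd ℂ) (∫ r in a..b, ⟪w, T r v⟫) =
      ∫ r in a..b, (starRingEnd ℂ) ⟪w, T r v⟫ :=
    ((Complex.conjCLE : ℂ →L[ℝ] ℂ).intervalIntegral_comp_comm
      ((continuous_const.inner (hT v)).intervalIntegrable a b)).symm
  rw [← inner_conj_symm, h1, h1, h2]
  refine intervalIntegral.integral_congr fun r _ => ?_
  simp only [inner_conj_symm]
  exact (ContinuousLinearMap.isSelfAdjoint_iff_isSymmetric.1 (hsa r)) v w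

end SelfAdjoint

/-! ### Strong continuity and strong integrals under the embedding of local algebras. -/

section EmbedStrong

variable {Γ : Type*} {H : Γ → Type*}
  [∀ x, NormedAddCommGroup (H x)] [∀ x, InnerProductSpace ℂ (H x)] [DecidableEq Γ]

theorem strongContinuous_embed {X Λ : Finset Γ} (h : X ⊆ Λ) {T : ℝ → LocalAlgebra H X}
    (hT : StrongContinuous T) {M : ℝ} (hM : ∀ r, ‖T r‖ ≤ M) :
    StrongContinuous fun r => embed h (T r) := by
  refine strongContinuous_of_dense (fun r => (norm_embed_le h _).trans (hM r))
    (dense_span_pureTensor Λ) fun v hv => ?_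
  induction hv using Submodule.span_induction with
  | mem x hx =>
    obtain ⟨g, rfl⟩ := hx
    simp only [embed_pureTensor]
    exact (slot h g).continuous.comp (hT _)
  | zero => simpa only [map_zero] using continuous_const
  | add x y _ _ hx hy => simp only [map_add]; exact hx.add hy
  | smul c x _ hx => simp only [map_smul]; exact hx.const_smul c

theorem embed_strong_integral {X Λ : Finset Γ} (h : X ⊆ Λ) {T : ℝ → LocalAlgebra H X}
    (hT : StrongContinuous T) {M : ℝ} (hM : ∀ r, ‖T r‖ ≤ M) {a b : ℝ} (hab : a ≤ b)
    {K : LocalAlgebra H X} (hK : ∀ v, K v = ∫ r in a..b, T r v) (v : LocalSpace H Λ) :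
    embed h K v = ∫ r in a..b, embed h (T r) v := by
  obtain ⟨K', hK', -⟩ := exists_strong_integral (strongContinuous_embed h hT hM)
    (fun r => (norm_embed_le h _).trans (hM r)) hab
  rw [← hK']
  refine DFunLike.congr_fun (ext_pureTensor fun g => ?_) v
  rw [hK', embed_pureTensor, hK]
  simp only [embed_pureTensor]
  exact ((slot h g).intervalIntegral_comp_comm ((hT _).intervalIntegrable a b)).symm

/-- Φ_Z is H_Z minus the terms of the proper subsets of Z, so continuity passes from the
Hamiltonians to the interaction by induction on Z. Clamping time to [0,1] provides the uniform
bounds needed to embed those terms. -/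
theorem strongContinuous_of_hamiltonian {Φ : (Z : Finset Γ) → ℝ → LocalAlgebra H Z}
    (hclamp : ∀ Z r, Φ Z r = Φ Z (Set.projIcc (0 : ℝ) 1 zero_le_one r))
    (hΦ : ∀ Λ, StrongContinuous (hamiltonian Φ Λ)) (Z : Finset Γ) :
    StrongContinuous (Φ Z) := by
  induction Z using Finset.strongInduction with
  | H Z ih =>
    have key : ∀ r, Φ Z r = hamiltonian Φ Z r -
        ∑ W ∈ Z.powerset.attach.erase ⟨Z, Finset.mem_powerset_self Z⟩,
          embed (Finset.mem_powerset.1 W.2) (Φ W r) := fun r => by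
      rw [hamiltonian, ← Finset.add_sum_erase _ _ (Finset.mem_attach _
        ⟨Z, Finset.mem_powerset_self Z⟩), embed_refl, add_sub_cancel_right]
    intro v
    simp only [key, sub_apply, sum_apply]
    refine (hΦ Z v).sub (continuous_finsetSum _ fun W hW => ?_)
    have hWZ : W.1 ⊂ Z := lt_of_le_of_ne (Finset.mem_powerset.1 W.2) fun e =>
      (Finset.mem_erase.1 hW).1 (Subtype.ext e)
    obtain ⟨M, hM⟩ := (ih W hWZ).exists_norm_le (hclamp W)
    exact strongContinuous_embed _ (ih W hWZ) hM v

end EmbedStrong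

/-! ### A perturbation estimate for commutators -/

section CStar

variable {R : Type*} [NormedRing R] [StarRing R] [CStarRing R]

theorem norm_one_le_of_cstar : ‖(1 : R)‖ ≤ 1 := by
  rcases subsingleton_or_nontrivial R with h | h
  · rw [Subsingleton.elim (1 : R) 0, norm_zero]; exact zero_le_one
  · exact CStarRing.norm_one.le

theorem norm_lie_le (a b : R) : ‖⁅a, b⁆‖ ≤ 2 * ‖a‖ * ‖b‖ := by
  rw [Ring.lie_def]
  calc ‖a * b - b * a‖ ≤ ‖a‖ * ‖b‖ + ‖b‖ * ‖a‖ :=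
        (norm_sub_le _ _).trans (add_le_add (norm_mul_le _ _) (norm_mul_le _ _))
    _ = _ := by ring

theorem norm_star_mul_mul_unitary {W : R} (hW : W ∈ unitary R) (A : R) :
    ‖star W * A * W‖ = ‖A‖ := by
  rw [CStarRing.norm_mul_mem_unitary _ hW, CStarRing.norm_mem_unitary_mul _ (Unitary.star_mem hW)]

/-- D + [J,D] = (1+J)D(1-J) + JDJ, and skewness gives ‖1+J‖² = ‖1-J²‖ ≤ 1 + ‖J‖². Hence there is no
first-order growth, unlike the bound 1 + 2‖J‖ from the triangle inequality. -/
theorem norm_add_lie_le {J D : R} (hJ : star J = -J) :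
    ‖D + ⁅J, D⁆‖ ≤ (1 + 2 * ‖J‖ ^ 2) * ‖D‖ := by
  have h1 : ‖1 + J‖ * ‖1 + J‖ ≤ 1 + ‖J‖ ^ 2 := by
    rw [← CStarRing.norm_star_mul_self, star_add, star_one, hJ]
    have : (1 + -J) * (1 + J) = 1 - J * J := by noncomm_ring
    rw [this, sq]
    exact (norm_sub_le _ _).trans (add_le_add norm_one_le_of_cstar (norm_mul_le _ _))
  have h2 : ‖1 - J‖ = ‖1 + J‖ := by
    rw [← norm_star (1 + J), star_add, star_one, hJ, sub_eq_add_neg]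
  have h3 : D + ⁅J, D⁆ = (1 + J) * D * (1 - J) + J * D * J := by
    rw [Ring.lie_def]; noncomm_ring
  rw [h3]
  calc _ ≤ ‖1 + J‖ * ‖D‖ * ‖1 - J‖ + ‖J‖ * ‖D‖ * ‖J‖ :=
        (norm_add_le _ _).trans (add_le_add (norm_mul₃_le) (norm_mul₃_le))
    _ = (‖1 + J‖ * ‖1 + J‖ + ‖J‖ ^ 2) * ‖D‖ := by rw [h2]; ring
    _ ≤ _ := by
      refine mul_le_mul_of_nonneg_right ?_ (norm_nonneg _)
      linarith

/-- If `W ≈ (1 - J - J') V` with `J` and `J'` skew-adjoint and `J'` commuting with `A`, then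
`[W* A W, B]` is controlled to first order by `[V* A V, B]` and `[V* J V, B]`. -/
theorem norm_lie_conj_le {V W J J' A B : R} (hV : V ∈ unitary R) (hW : W ∈ unitary R)
    (hJ : star J = -J) (hJ' : star J' = -J') (hA : Commute J' A) {ε k : ℝ}
    (hε : ‖W - V + (J + J') * V‖ ≤ ε) (hk : ‖J‖ ≤ k) (hk' : ‖J + J'‖ ≤ k) :
    ‖⁅star W * A * W, B⁆‖ ≤ ‖⁅star V * A * V, B⁆‖ + 2 * ‖A‖ * ‖⁅star V * J * V, B⁆‖ +
      ‖A‖ * (‖B‖ * (6 * k ^ 2 + 2 * (ε * (2 + ε)))) := by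
  have hε0 : 0 ≤ ε := (norm_nonneg _).trans hε
  have hk0 : 0 ≤ k := (norm_nonneg _).trans hk
  set E := W - V + (J + J') * V with hE
  set T := star V * A * V with hT
  set L := star V * J * V with hL
  set Q := star W * A * E + star E * A * W - star E * A * E -
    star V * ((J + J') * A * (J + J')) * V with hQ
  have hVV : V * star V = 1 := Unitary.mul_star_self_of_mem hV
  have hTn : ‖T‖ = ‖A‖ := norm_star_mul_mul_unitary hV A
  have hLn : ‖L‖ = ‖J‖ := norm_star_mul_mul_unitary hV J
  have hLs : star L = -L := by
    rw [hL, star_mul, star_mul, star_star, hJ]; noncomm_ring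
  have hLT : ⁅L, T⁆ = star V * ⁅J, A⁆ * V := by
    rw [Ring.lie_def, Ring.lie_def, hL, hT]
    calc _ = star V * J * (V * star V) * A * V - star V * A * (V * star V) * J * V := by
          noncomm_ring
      _ = _ := by rw [hVV]; noncomm_ring
  -- W - E is exactly (1 - J - J')V. Expanding its conjugation of A, the first-order part loses J'
  -- because J' commutes with A; the quadratic part and all terms in E form Q.
  have hdec : star W * A * W = T + ⁅L, T⁆ + Q := by
    have hWE : W = (1 - (J + J')) * V + E := by rw [hE]; noncomm_ring
    have hWs : star W = star V * (1 + (J + J')) + star E := by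
      conv_lhs => rw [hWE]
      rw [star_add, star_mul, star_sub, star_add, hJ, hJ', star_one]
      noncomm_ring
    have h1 : ⁅J, A⁆ = (J + J') * A - A * (J + J') := by
      rw [Ring.lie_def, add_mul, mul_add, hA.eq]; abel
    have h2 : (star W - star E) * A * (W - E) = T + ⁅L, T⁆ -
        star V * ((J + J') * A * (J + J')) * V := by
      rw [hLT, h1, hT, hWs, sub_eq_of_eq_add hWE]
      noncomm_ring
    rw [hQ]
    calc star W * A * W = (star W - star E) * A * (W - E) + (star W * A * E + star E * A * W -
          star E * A * E) := by noncomm_ring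
      _ = _ := by rw [h2]; abel
  have hQn : ‖Q‖ ≤ ‖A‖ * (k ^ 2 + ε * (2 + ε)) := by
    have e1 : ‖star W * A * E‖ ≤ ‖A‖ * ε := by
      rw [mul_assoc, CStarRing.norm_mem_unitary_mul _ (Unitary.star_mem hW)]
      exact (norm_mul_le _ _).trans (by gcongr)
    have e2 : ‖star E * A * W‖ ≤ ε * ‖A‖ := by
      rw [CStarRing.norm_mul_mem_unitary _ hW]
      exact (norm_mul_le _ _).trans (by rw [norm_star]; gcongr)
    have e3 : ‖star E * A * E‖ ≤ ε * ‖A‖ * ε :=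
      (norm_mul₃_le).trans (by rw [norm_star]; gcongr)
    have e4 : ‖star V * ((J + J') * A * (J + J')) * V‖ ≤ k * ‖A‖ * k := by
      rw [norm_star_mul_mul_unitary hV]
      exact (norm_mul₃_le).trans (by gcongr)
    calc ‖Q‖ ≤ ‖star W * A * E‖ + ‖star E * A * W‖ + ‖star E * A * E‖ +
          ‖star V * ((J + J') * A * (J + J')) * V‖ :=
          (norm_sub_le _ _).trans (add_le_add ((norm_sub_le _ _).trans
            (add_le_add (norm_add_le _ _) le_rfl)) le_rfl)
      _ ≤ _ := by linarith
  -- Jacobi identity, grouped so that `norm_add_lie_le` applies to the first bracket.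
  have hjac : ⁅star W * A * W, B⁆ = (⁅T, B⁆ + ⁅L, ⁅T, B⁆⁆) - ⁅T, ⁅L, B⁆⁆ + ⁅Q, B⁆ := by
    rw [hdec]
    simp only [Ring.lie_def]
    noncomm_ring
  have hD : ‖⁅T, B⁆‖ ≤ 2 * ‖A‖ * ‖B‖ := (norm_lie_le _ _).trans_eq (by rw [hTn])
  have hk2 : ‖L‖ ^ 2 ≤ k ^ 2 := by rw [hLn]; gcongr
  rw [hjac]
  calc _ ≤ ‖⁅T, B⁆ + ⁅L, ⁅T, B⁆⁆‖ + ‖⁅T, ⁅L, B⁆⁆‖ + ‖⁅Q, B⁆‖ :=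
        (norm_add_le _ _).trans (add_le_add (norm_sub_le _ _) le_rfl)
    _ ≤ (1 + 2 * ‖L‖ ^ 2) * ‖⁅T, B⁆‖ + 2 * ‖T‖ * ‖⁅L, B⁆‖ + 2 * ‖Q‖ * ‖B‖ :=
        add_le_add (add_le_add (norm_add_lie_le hLs) (norm_lie_le _ _)) (norm_lie_le _ _)
    _ = ‖⁅T, B⁆‖ + 2 * ‖A‖ * ‖⁅L, B⁆‖ + (2 * ‖L‖ ^ 2 * ‖⁅T, B⁆‖ + 2 * ‖Q‖ * ‖B‖) := by
        rw [hTn]; ring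
    _ ≤ ‖⁅T, B⁆‖ + 2 * ‖A‖ * ‖⁅L, B⁆‖ + (2 * k ^ 2 * (2 * ‖A‖ * ‖B‖) +
        2 * (‖A‖ * (k ^ 2 + ε * (2 + ε))) * ‖B‖) := by gcongr
    _ = _ := by ring

end CStar

/-! ### Short time estimate and comparison -/

section Step

variable {Γ : Type*} {H : Γ → Type*}
  [∀ x, NormedAddCommGroup (H x)] [∀ x, InnerProductSpace ℂ (H x)] [DecidableEq Γ]

/-- `K Z` is the strong integral of Φ_Z over [s, s+h]. It is chosen before X, A and B, and being an
element of 𝓐_Z it can itself be fed into a bound on commutators at time s. -/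
theorem exists_step {Φ : (Z : Finset Γ) → ℝ → LocalAlgebra H Z}
    (hΦ : ∀ Z, StrongContinuous (Φ Z)) (hsa : ∀ Z r, IsSelfAdjoint (Φ Z r))
    {b : Finset Γ → ℝ} (hb : ∀ Z r, ‖Φ Z r‖ ≤ b Z) {Λ : Finset Γ} {V : ℝ → LocalAlgebra H Λ}
    (hV : ∀ r ∈ Set.Icc (0 : ℝ) 1, V r ∈ unitary (LocalAlgebra H Λ))
    (hd : ∀ v, ∀ r ∈ Set.Icc (0 : ℝ) 1, HasDerivWithinAt (fun r => V r v)
      (-(Complex.I • hamiltonian Φ Λ r (V r v))) (Set.Icc 0 1) r)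
    {s h : ℝ} (hs : 0 ≤ s) (hh : 0 ≤ h) (hsh : s + h ≤ 1)
    {M : ℝ} (hM : M = ∑ Z ∈ Λ.powerset, b Z) :
    ∃ K : (Z : Finset Γ) → LocalAlgebra H Z, (∀ Z, ‖K Z‖ ≤ h * b Z) ∧
      ∀ {X : Finset Γ} (hX : X ⊆ Λ) (A : LocalAlgebra H X) (B : LocalAlgebra H Λ),
        ‖⁅star (V (s + h)) * embed hX A * V (s + h), B⁆‖ ≤
          ‖⁅star (V s) * embed hX A * V s, B⁆‖ +
          2 * ‖A‖ * (∑ Z ∈ Λ.powerset.attach, if Disjoint X Z.1 then 0 else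
            ‖⁅star (V s) * embed (Finset.mem_powerset.1 Z.2) (K Z) * V s, B⁆‖) +
          ‖A‖ * (‖B‖ * (6 * M ^ 2 + 2 * (M ^ 2 * (2 + M ^ 2))) * h ^ 2) := by
  have hsh' : s ≤ s + h := by linarith
  choose K hK hKn using fun Z => exists_strong_integral (hΦ Z) (hb Z) hsh'
  simp only [add_sub_cancel_left] at hKn
  refine ⟨K, hKn, fun {X} hX A B => ?_⟩
  have hb0 : ∀ Z, 0 ≤ b Z := fun Z => (norm_nonneg _).trans (hb Z 0)
  have hIcc : Set.Icc s (s + h) ⊆ Set.Icc (0 : ℝ) 1 := Set.Icc_subset_Icc hs hsh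
  let κ : {Z // Z ∈ Λ.powerset} → LocalAlgebra H Λ := fun Z =>
    Complex.I • embed (Finset.mem_powerset.1 Z.2) (K Z)
  have hκn : ∀ Z, ‖κ Z‖ ≤ h * b Z := fun Z => by
    rw [norm_smul, Complex.norm_I, one_mul]
    exact (norm_embed_le _ _).trans (hKn _)
  have hκs : ∀ Z, star (κ Z) = -κ Z := fun Z => by
    have := (isSelfAdjoint_strong_integral (hΦ Z.1) (hsa Z.1) (hK Z.1)).star_eq
    rw [star_smul, star_embed, this, RCLike.star_def, Complex.conj_I, neg_smul]
  let S : Finset {Z // Z ∈ Λ.powerset} := Λ.powerset.attach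
  let J : LocalAlgebra H Λ := ∑ Z ∈ S with ¬ Disjoint X Z.1, κ Z
  let J' : LocalAlgebra H Λ := ∑ Z ∈ S with Disjoint X Z.1, κ Z
  have hskew : ∀ S' : Finset {Z // Z ∈ Λ.powerset}, star (∑ Z ∈ S', κ Z) = -∑ Z ∈ S', κ Z :=
    fun S' => by simp only [star_sum, hκs, Finset.sum_neg_distrib]
  have hnorm : ∀ S' : Finset {Z // Z ∈ Λ.powerset}, S' ⊆ S → ‖∑ Z ∈ S', κ Z‖ ≤ h * M :=
    fun S' hS' => by
      refine (norm_sum_le_of_le S' fun Z _ => hκn Z).trans ?_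
      rw [hM, Finset.mul_sum, ← Finset.sum_attach Λ.powerset]
      exact Finset.sum_le_sum_of_subset_of_nonneg hS' fun Z _ _ => mul_nonneg hh (hb0 _)
  have hsum : J + J' = ∑ Z ∈ S, κ Z := by
    rw [add_comm]; exact Finset.sum_filter_add_sum_filter_not S _ _
  have hcomm : Commute J' (embed hX A) := by
    refine Commute.sum_left _ _ _ fun Z hZ => ?_
    exact (commute_embed _ hX (Finset.mem_filter.1 hZ).2.symm _ _).smul_left _
  have hHs : StrongContinuous (hamiltonian Φ Λ) := fun v => by
    simp only [hamiltonian, sum_apply]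
    exact continuous_finsetSum _ fun Z _ => strongContinuous_embed _ (hΦ _) (hb _) v
  have hHn : ∀ r, ‖hamiltonian Φ Λ r‖ ≤ M := fun r => by
    rw [hM, ← Finset.sum_attach Λ.powerset]
    exact norm_sum_le_of_le _ fun Z _ => (norm_embed_le _ _).trans (hb _ _)
  let KΛ : LocalAlgebra H Λ := ∑ Z ∈ S, embed (Finset.mem_powerset.1 Z.2) (K Z)
  have hKΛ : ∀ v, KΛ v = ∫ r in s..s + h, hamiltonian Φ Λ r v := fun v => by
    simp only [KΛ, hamiltonian, sum_apply]
    rw [intervalIntegral.integral_finsetSum fun Z _ =>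
      (strongContinuous_embed _ (hΦ _) (hb _) v).intervalIntegrable _ _]
    exact Finset.sum_congr rfl fun Z _ =>
      embed_strong_integral _ (hΦ _) (hb _) hsh' (hK _) v
  have hE := norm_propagator_sub_le hHs hHn hsh' (V := V) (fun r hr v => by
      have h1 : ‖V r‖ ≤ 1 := by
        have := CStarRing.norm_mul_mem_unitary (1 : LocalAlgebra H Λ) (hV r (hIcc hr))
        rw [one_mul] at this
        exact this.le.trans norm_one_le_of_cstar
      exact ((V r).le_of_opNorm_le h1 v).trans_eq (one_mul _))
    (fun v r hr => (hd v r (hIcc hr)).mono hIcc) hKΛ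
  have hIK : Complex.I • KΛ = J + J' := by
    rw [hsum, Finset.smul_sum]
  rw [hIK, add_sub_cancel_left] at hE
  have key := norm_lie_conj_le (hV s (hIcc ⟨le_rfl, hsh'⟩)) (hV (s + h) (hIcc ⟨hsh', le_rfl⟩))
    (hskew _) (hskew _) hcomm hE (B := B) (hnorm _ (Finset.filter_subset _ _))
    (by rw [hsum]; exact hnorm _ subset_rfl)
  have hA : ‖embed hX A‖ ≤ ‖A‖ := norm_embed_le hX A
  have hJB : ‖⁅star (V s) * J * V s, B⁆‖ ≤ ∑ Z ∈ Λ.powerset.attach, if Disjoint X Z.1 then 0 else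
      ‖⁅star (V s) * embed (Finset.mem_powerset.1 Z.2) (K Z) * V s, B⁆‖ := by
    simp only [J, Ring.lie_def, Finset.mul_sum, Finset.sum_mul, ← Finset.sum_sub_distrib]
    refine (norm_sum_le _ _).trans ?_
    rw [Finset.sum_filter]
    refine Finset.sum_le_sum fun Z _ => ?_
    by_cases h1 : Disjoint X Z.1
    · simp [h1]
    · simp only [h1, not_false_eq_true, if_true, if_false, κ, mul_smul_comm, smul_mul_assoc]
      rw [← smul_sub, norm_smul, Complex.norm_I, one_mul]
  -- `norm_lie_conj_le` is used with k = hM and ε = h²M²; h ≤ 1 absorbs the h⁴ term of the error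
  -- into h².
  have hh1 : h ^ 2 ≤ 1 := pow_le_one₀ hh (by linarith)
  refine key.trans (add_le_add (add_le_add le_rfl ?_) ?_)
  · gcongr
  · refine mul_le_mul hA ?_ (by positivity) (norm_nonneg _)
    rw [mul_assoc ‖B‖]
    refine mul_le_mul_of_nonneg_left ?_ (norm_nonneg _)
    have h2 : h ^ 2 * M ^ 2 * (2 + h ^ 2 * M ^ 2) ≤ h ^ 2 * M ^ 2 * (2 + 1 * M ^ 2) := by gcongr
    nlinarith [h2]

/-- Comparison of the commutators `[τ_t(A), B]` with a supersolution `w` of the linear system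
`w_X' = 2 ∑_{Z ∩ X ≠ ∅} b_Z w_Z`. -/
theorem norm_lie_le_supersolution {Φ : (Z : Finset Γ) → ℝ → LocalAlgebra H Z}
    (hΦ : ∀ Z, StrongContinuous (Φ Z)) (hsa : ∀ Z r, IsSelfAdjoint (Φ Z r))
    {b : Finset Γ → ℝ} (hb : ∀ Z r, ‖Φ Z r‖ ≤ b Z) {Λ : Finset Γ} {V : ℝ → LocalAlgebra H Λ}
    (hV : ∀ r ∈ Set.Icc (0 : ℝ) 1, V r ∈ unitary (LocalAlgebra H Λ))
    (hd : ∀ v, ∀ r ∈ Set.Icc (0 : ℝ) 1, HasDerivWithinAt (fun r => V r v)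
      (-(Complex.I • hamiltonian Φ Λ r (V r v))) (Set.Icc 0 1) r)
    {B : LocalAlgebra H Λ} {w : Finset Γ → ℝ → ℝ}
    (hw0 : ∀ {X : Finset Γ} (hX : X ⊆ Λ) (A : LocalAlgebra H X),
      ‖⁅star (V 0) * embed hX A * V 0, B⁆‖ ≤ ‖A‖ * w X 0)
    (hw_nonneg : ∀ X r, 0 ≤ r → 0 ≤ w X r)
    (hw : ∀ X ⊆ Λ, ∀ s h : ℝ, 0 ≤ s → 0 ≤ h →
      w X s + 2 * h * (∑ Z ∈ Λ.powerset, if Disjoint X Z then 0 else b Z * w Z s) ≤ w X (s + h))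
    {t : ℝ} (ht : t ∈ Set.Icc (0 : ℝ) 1) {X : Finset Γ} (hX : X ⊆ Λ) (A : LocalAlgebra H X) :
    ‖⁅star (V t) * embed hX A * V t, B⁆‖ ≤ ‖A‖ * w X t := by
  have hb0 : ∀ Z, 0 ≤ b Z := fun Z => (norm_nonneg _).trans (hb Z 0)
  obtain ⟨M, hM⟩ : ∃ M, M = ∑ Z ∈ Λ.powerset, b Z := ⟨_, rfl⟩
  have hM0 : 0 ≤ M := hM ▸ Finset.sum_nonneg fun Z _ => hb0 Z
  obtain ⟨κ, hκ⟩ : ∃ κ, κ = ‖B‖ * (6 * M ^ 2 + 2 * (M ^ 2 * (2 + M ^ 2))) := ⟨_, rfl⟩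
  have hκ0 : 0 ≤ κ := by rw [hκ]; positivity
  -- One Euler step turns an excess e over w into e(1 + 2hM) + κh². The hypothesis covers all X and
  -- A at once, because it is applied to the operators `K Z`.
  have step : ∀ s h e : ℝ, 0 ≤ s → 0 ≤ h → s + h ≤ 1 → 0 ≤ e →
      (∀ {X : Finset Γ} (hX : X ⊆ Λ) (A : LocalAlgebra H X),
        ‖⁅star (V s) * embed hX A * V s, B⁆‖ ≤ ‖A‖ * (w X s + e)) →
      ∀ {X : Finset Γ} (hX : X ⊆ Λ) (A : LocalAlgebra H X),
        ‖⁅star (V (s + h)) * embed hX A * V (s + h), B⁆‖ ≤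
          ‖A‖ * (w X (s + h) + (e * (1 + 2 * h * M) + κ * h ^ 2)) := by
    intro s h e hs hh hsh he ih X hX A
    obtain ⟨K, hKn, hK⟩ := exists_step hΦ hsa hb hV hd hs hh hsh hM
    have h1 : (∑ Z ∈ Λ.powerset.attach, if Disjoint X Z.1 then 0 else
        ‖⁅star (V s) * embed (Finset.mem_powerset.1 Z.2) (K Z) * V s, B⁆‖) ≤
        h * (∑ Z ∈ Λ.powerset, if Disjoint X Z then 0 else b Z * w Z s) + h * M * e := by
      rw [hM, mul_assoc, ← mul_add, Finset.sum_mul, ← Finset.sum_add_distrib, Finset.mul_sum,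
        ← Finset.sum_attach Λ.powerset]
      refine Finset.sum_le_sum fun Z _ => ?_
      split_ifs with hd
      · have := hb0 Z.1
        positivity
      · refine (ih _ (K Z)).trans ?_
        refine (mul_le_mul_of_nonneg_right (hKn Z)
          (add_nonneg (hw_nonneg _ _ hs) he)).trans_eq ?_
        ring
    refine (hK hX A B).trans ?_
    rw [← hκ]
    calc _ ≤ ‖A‖ * (w X s + e) + 2 * ‖A‖ * (h * (∑ Z ∈ Λ.powerset,
          if Disjoint X Z then 0 else b Z * w Z s) + h * M * e) + ‖A‖ * (κ * h ^ 2) :=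
          add_le_add (add_le_add (ih hX A) (mul_le_mul_of_nonneg_left h1 (by positivity))) le_rfl
      _ = ‖A‖ * ((w X s + 2 * h * (∑ Z ∈ Λ.powerset,
          if Disjoint X Z then 0 else b Z * w Z s)) + (e * (1 + 2 * h * M) + κ * h ^ 2)) := by
          ring
      _ ≤ _ := by
          refine mul_le_mul_of_nonneg_left ?_ (norm_nonneg _)
          exact add_le_add (hw X hX s h hs hh) le_rfl
  have iter : ∀ h : ℝ, 0 ≤ h → ∀ k : ℕ, k * h ≤ 1 →
      ∀ {X : Finset Γ} (hX : X ⊆ Λ) (A : LocalAlgebra H X),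
        ‖⁅star (V (k * h)) * embed hX A * V (k * h), B⁆‖ ≤
          ‖A‖ * (w X (k * h) + κ * h ^ 2 * k * (1 + 2 * h * M) ^ k) := by
    intro h hh k
    induction k with
    | zero =>
      intro _ X hX A
      simpa using hw0 hX A
    | succ k ih =>
      intro hk X hX A
      have hk' : ((k + 1 : ℕ) : ℝ) * h = k * h + h := by push_cast; ring
      rw [hk'] at hk ⊢
      refine (step (k * h) h _ (by positivity) hh hk (by positivity) (ih (by linarith))
        hX A).trans ?_
      refine mul_le_mul_of_nonneg_left (add_le_add le_rfl ?_) (norm_nonneg _)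
      have h1 : 1 ≤ (1 + 2 * h * M) ^ (k + 1) := one_le_pow₀ (by
        have : 0 ≤ 2 * h * M := by positivity
        linarith)
      have h2 : κ * h ^ 2 * 1 ≤ κ * h ^ 2 * (1 + 2 * h * M) ^ (k + 1) :=
        mul_le_mul_of_nonneg_left h1 (by positivity)
      push_cast
      rw [mul_one] at h2
      refine (add_le_add le_rfl h2).trans_eq ?_
      rw [pow_succ (1 + 2 * h * M)]
      ring
  -- With n + 1 steps of length t/(n+1), the accumulated excess is at most κt²e^{2tM}/(n+1), which
  -- vanishes in the limit.
  have hbound : ∀ n : ℕ, ‖⁅star (V t) * embed hX A * V t, B⁆‖ ≤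
      ‖A‖ * (w X t + κ * t ^ 2 * Real.exp (2 * t * M) * (1 / ((n : ℝ) + 1))) := fun n => by
    have hn : (0 : ℝ) < (n : ℝ) + 1 := by positivity
    have ht0 := ht.1
    have e1 : ((n + 1 : ℕ) : ℝ) * (t / (n + 1)) = t := by push_cast; field_simp
    have := iter (t / (n + 1)) (by positivity) (n + 1) (by rw [e1]; exact ht.2) hX A
    rw [e1] at this
    refine this.trans (mul_le_mul_of_nonneg_left (add_le_add le_rfl ?_) (norm_nonneg _))
    have e2 : (1 + 2 * (t / (n + 1)) * M) ^ (n + 1) ≤ Real.exp (2 * t * M) := by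
      have h1 : (1 + 2 * (t / (n + 1)) * M) ≤ Real.exp (2 * (t / (n + 1)) * M) := by
        rw [add_comm]; exact Real.add_one_le_exp _
      refine (pow_le_pow_left₀ (by positivity) h1 _).trans_eq ?_
      rw [← Real.exp_nat_mul]
      congr 1
      push_cast
      field_simp
    have e3 : κ * (t / (n + 1)) ^ 2 * ((n + 1 : ℕ) : ℝ) = κ * t ^ 2 * (1 / ((n : ℝ) + 1)) := by
      push_cast; field_simp
    rw [e3]
    calc _ ≤ κ * t ^ 2 * (1 / ((n : ℝ) + 1)) * Real.exp (2 * t * M) := by gcongr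
      _ = _ := by ring
  have hlim := ((tendsto_one_div_add_atTop_nhds_zero_nat (𝕜 := ℝ)).const_mul
    (κ * t ^ 2 * Real.exp (2 * t * M))).const_add (w X t) |>.const_mul ‖A‖
  rw [mul_zero, add_zero] at hlim
  exact ge_of_tendsto' hlim hbound

end Step

/-! ### Summability estimates -/

section Sums

variable {Γ : Type*} [MetricSpace Γ]

theorem ConvolutionCondition.sum_le {F : ℝ → ℝ} (hF : ∀ r, 0 ≤ r → 0 < F r) {C : ℝ} (hC : 0 ≤ C)
    (h : ConvolutionCondition Γ F C) (Λ : Finset Γ) (x y : Γ) :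
    ∑ z ∈ Λ, F (dist x z) * F (dist z y) ≤ C * F (dist x y) := by
  have h0 : ∀ x y : Γ, 0 ≤ F (dist x y) := fun x y => (hF _ dist_nonneg).le
  rw [← ENNReal.ofReal_le_ofReal_iff (mul_nonneg hC (h0 x y)),
    ENNReal.ofReal_sum_of_nonneg fun z _ => mul_nonneg (h0 x z) (h0 z y)]
  exact (ENNReal.sum_le_tsum Λ).trans (h x y)

variable [DecidableEq Γ]

/-- Union bounds replace "Z meets X" and "Z meets Y" by sums over common points. The terms without q
then give ∑_{Z ∋ x,y} b_Z ≤ N F(d(x,y)). Those with q give N ∑_z F(d(x,z))F(d(z,y)), which the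
convolution bound closes with the factor C. -/
theorem sum_interaction_le {F : ℝ → ℝ} (hF : ∀ r, 0 ≤ r → 0 < F r) {C : ℝ}
    {Λ : Finset Γ} (hC : ∀ x y : Γ, ∑ z ∈ Λ, F (dist x z) * F (dist z y) ≤ C * F (dist x y))
    {b : Finset Γ → ℝ} (hb0 : ∀ Z, 0 ≤ b Z) {N : ℝ} (hN : 0 ≤ N)
    (hb : ∀ x y : Γ, ∑ Z ∈ Λ.powerset with x ∈ Z ∧ y ∈ Z, b Z ≤ N * F (dist x y))
    (X Y : Finset Γ) {q : ℝ} (hq : 0 ≤ q) :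
    (∑ Z ∈ Λ.powerset, if Disjoint X Z then 0 else
      b Z * ((if Disjoint Z Y then 0 else 1) + q * ∑ z ∈ Z, ∑ y ∈ Y, F (dist z y))) ≤
    N * (1 + C * q) * ∑ x ∈ X, ∑ y ∈ Y, F (dist x y) := by
  have h0 : ∀ x y : Γ, 0 ≤ F (dist x y) := fun x y => (hF _ dist_nonneg).le
  have key : ∀ {P Q : Finset Γ} {c : ℝ}, 0 ≤ c →
      (if Disjoint P Q then 0 else c) ≤ ∑ x ∈ P, if x ∈ Q then c else 0 := by
    intro P Q c hc
    split_ifs with hd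
    · exact Finset.sum_nonneg fun x _ => by split_ifs <;> simp [hc]
    · obtain ⟨x, hx, hx'⟩ := Finset.not_disjoint_iff.1 hd
      refine le_trans ?_ (Finset.single_le_sum (fun x _ => ?_) hx)
      · simp [hx']
      · split_ifs <;> simp [hc]
  let G : Γ → Γ → ℝ := fun x y => ∑ Z ∈ Λ.powerset, if x ∈ Z then (if y ∈ Z then b Z else 0) else 0
  have hG : ∀ x y, G x y ≤ N * F (dist x y) := fun x y => by
    refine le_trans (le_of_eq ?_) (hb x y)
    rw [Finset.sum_filter]
    refine Finset.sum_congr rfl fun Z _ => ?_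
    by_cases h1 : x ∈ Z <;> by_cases h2 : y ∈ Z <;> simp [h1, h2]
  calc _ ≤ ∑ Z ∈ Λ.powerset, ∑ x ∈ X, ∑ y ∈ Y,
        ((if x ∈ Z then (if y ∈ Z then b Z else 0) else 0) +
          q * ∑ z ∈ Λ, (if x ∈ Z then (if z ∈ Z then b Z else 0) else 0) * F (dist z y)) := by
        refine Finset.sum_le_sum fun Z hZ => ?_
        have hZΛ := Finset.mem_powerset.1 hZ
        refine (key (mul_nonneg (hb0 Z) (add_nonneg (by split_ifs <;> simp)
          (mul_nonneg hq (Finset.sum_nonneg fun z _ => Finset.sum_nonneg fun y _ =>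
            h0 z y))))).trans ?_
        refine Finset.sum_le_sum fun x _ => ?_
        by_cases hx : x ∈ Z
        · simp only [hx, if_true]
          have e1 : (if Disjoint Z Y then (0 : ℝ) else 1) ≤ ∑ y ∈ Y, if y ∈ Z then 1 else 0 := by
            simp only [disjoint_comm (a := Z)]; exact key zero_le_one
          have e2 : ∑ z ∈ Z, ∑ y ∈ Y, F (dist z y) =
              ∑ y ∈ Y, ∑ z ∈ Λ, (if z ∈ Z then 1 else 0) * F (dist z y) := by
            rw [Finset.sum_comm]
            refine Finset.sum_congr rfl fun y _ => ?_
            simp only [ite_mul, one_mul, zero_mul]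
            rw [← Finset.sum_filter, Finset.filter_mem_eq_inter, Finset.inter_eq_right.2 hZΛ]
          refine (mul_le_mul_of_nonneg_left (add_le_add e1 le_rfl) (hb0 Z)).trans (le_of_eq ?_)
          rw [e2, Finset.mul_sum, ← Finset.sum_add_distrib, Finset.mul_sum]
          refine Finset.sum_congr rfl fun y _ => ?_
          rw [mul_add, mul_left_comm, Finset.mul_sum]
          congr 1
          · simp
          · congr 1
            refine Finset.sum_congr rfl fun z _ => ?_
            split_ifs <;> ring
        · simp [hx]
    _ = ∑ x ∈ X, ∑ y ∈ Y, (G x y + q * ∑ z ∈ Λ, G x z * F (dist z y)) := by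
        rw [Finset.sum_comm]
        refine Finset.sum_congr rfl fun x _ => ?_
        rw [Finset.sum_comm]
        refine Finset.sum_congr rfl fun y _ => ?_
        rw [Finset.sum_add_distrib, ← Finset.mul_sum, Finset.sum_comm]
        simp only [G, Finset.sum_mul]
    _ ≤ ∑ x ∈ X, ∑ y ∈ Y, N * (1 + C * q) * F (dist x y) := by
        refine Finset.sum_le_sum fun x _ => Finset.sum_le_sum fun y _ => ?_
        have e1 : ∑ z ∈ Λ, G x z * F (dist z y) ≤ N * (C * F (dist x y)) := by
          refine le_trans ?_ (mul_le_mul_of_nonneg_left (hC x y) hN)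
          rw [Finset.mul_sum]
          refine Finset.sum_le_sum fun z _ => ?_
          rw [← mul_assoc]
          exact mul_le_mul_of_nonneg_right (hG x z) (h0 z y)
        calc _ ≤ N * F (dist x y) + q * (N * (C * F (dist x y))) :=
              add_le_add (hG x y) (mul_le_mul_of_nonneg_left e1 hq)
          _ = _ := by ring
    _ = _ := by simp only [Finset.mul_sum]

/-- Finiteness makes the infimum a minimum of distances; if a set is empty, it is ∞. -/
theorem setDist_pos_iff {X Y : Finset Γ} : 0 < setDist X Y ↔ Disjoint X Y := by
  rw [setDist]
  constructor
  · intro h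
    refine Finset.disjoint_left.2 fun x hx hy => h.ne' (le_antisymm ?_ bot_le)
    exact (iInf₂_le x hx).trans ((iInf₂_le x hy).trans (edist_self x).le)
  · intro h
    simp only [← Finset.inf_eq_iInf]
    rw [Finset.lt_inf_iff ENNReal.zero_lt_top]
    intro x hx
    rw [Finset.lt_inf_iff ENNReal.zero_lt_top]
    intro y hy
    exact edist_pos.2 fun e => Finset.disjoint_left.1 h hx (e ▸ hy)

variable {H : Γ → Type*} [∀ x, NormedAddCommGroup (H x)] [∀ x, InnerProductSpace ℂ (H x)]

theorem sum_enorm_le_interactionNorm {F : ℝ → ℝ} (hF : ∀ r, 0 ≤ r → 0 < F r)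
    (Φ : (Z : Finset Γ) → ℝ → LocalAlgebra H Z) (Λ : Finset Γ) (x y : Γ) :
    ∑ Z ∈ Λ.powerset with x ∈ Z ∧ y ∈ Z, (⨆ t ∈ Set.Icc (0 : ℝ) 1, ‖Φ Z t‖ₑ) ≤
      interactionNorm F Φ * ENNReal.ofReal (F (dist x y)) := by
  have h1 : (∑' Z : {Z : Finset Γ // x ∈ Z ∧ y ∈ Z}, ⨆ t ∈ Set.Icc (0 : ℝ) 1, ‖Φ Z t‖ₑ) /
      ENNReal.ofReal (F (dist x y)) ≤ interactionNorm F Φ :=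
    le_iSup₂ (f := fun x y => (∑' Z : {Z : Finset Γ // x ∈ Z ∧ y ∈ Z},
      ⨆ t ∈ Set.Icc (0 : ℝ) 1, ‖Φ Z t‖ₑ) / ENNReal.ofReal (F (dist x y))) x y
  rw [ENNReal.div_le_iff (ENNReal.ofReal_pos.2 (hF _ dist_nonneg)).ne' ENNReal.ofReal_ne_top] at h1
  refine le_trans ?_ h1
  rw [← Finset.sum_subtype_eq_sum_filter]
  exact ENNReal.sum_le_tsum _

/-- ‖Φ‖_F controls sup_t ‖Φ_Z(t)‖ only through a point of Z, so Z = ∅ needs the separate bound `M`.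
That value never enters the sums over Z ∋ x, y. -/
theorem exists_interaction_bound {F : ℝ → ℝ} (hF : ∀ r, 0 ≤ r → 0 < F r)
    {Φ : (Z : Finset Γ) → ℝ → LocalAlgebra H Z} (hΦ : interactionNorm F Φ < ⊤)
    {M : ℝ} (hM : ∀ t ∈ Set.Icc (0 : ℝ) 1, ‖Φ ∅ t‖ ≤ M) :
    ∃ b : Finset Γ → ℝ, (∀ Z, ∀ t ∈ Set.Icc (0 : ℝ) 1, ‖Φ Z t‖ ≤ b Z) ∧
      ∀ (Λ : Finset Γ) (x y : Γ), ∑ Z ∈ Λ.powerset with x ∈ Z ∧ y ∈ Z, b Z ≤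
        (interactionNorm F Φ).toReal * F (dist x y) := by
  let p : Finset Γ → ℝ≥0∞ := fun Z => ⨆ t ∈ Set.Icc (0 : ℝ) 1, ‖Φ Z t‖ₑ
  have hfin : ∀ x y : Γ, interactionNorm F Φ * ENNReal.ofReal (F (dist x y)) ≠ ⊤ := fun x y =>
    ENNReal.mul_ne_top hΦ.ne ENNReal.ofReal_ne_top
  have hp : ∀ Z : Finset Γ, Z ≠ ∅ → p Z ≠ ⊤ := fun Z hZ => by
    obtain ⟨x, hx⟩ := Finset.nonempty_iff_ne_empty.2 hZ
    refine ne_top_of_le_ne_top (hfin x x) (le_trans ?_ (sum_enorm_le_interactionNorm hF Φ Z x x))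
    exact Finset.single_le_sum (f := p) (fun _ _ => bot_le)
      (Finset.mem_filter.2 ⟨Finset.mem_powerset_self Z, hx, hx⟩)
  refine ⟨fun Z => if Z = ∅ then M else (p Z).toReal, fun Z t ht => ?_, fun Λ x y => ?_⟩
  · by_cases hZ : Z = ∅
    · subst hZ
      simpa using hM t ht
    · simp only [hZ, if_false]
      rw [← toReal_enorm]
      exact ENNReal.toReal_mono (hp Z hZ) (le_iSup₂ (f := fun t _ => ‖Φ Z t‖ₑ) t ht)
  · have h1 := ENNReal.toReal_mono (hfin x y) (sum_enorm_le_interactionNorm hF Φ Λ x y)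
    have hne : ∀ Z ∈ Λ.powerset.filter (fun Z => x ∈ Z ∧ y ∈ Z), Z ≠ ∅ := fun Z hZ =>
      Finset.ne_empty_of_mem (Finset.mem_filter.1 hZ).2.1
    rw [ENNReal.toReal_mul, ENNReal.toReal_ofReal (hF _ dist_nonneg).le,
      ENNReal.toReal_sum fun Z hZ => hp Z (hne Z hZ)] at h1
    refine le_trans (le_of_eq (Finset.sum_congr rfl fun Z hZ => ?_)) h1
    exact if_neg (hne Z hZ)

end Sums

/-- The Lieb-Robinson bound, without the hypotheses on `F` that only matter in infinite volume. -/
theorem norm_lie_heisenberg_le {Γ : Type*} [MetricSpace Γ] [DecidableEq Γ]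
    {H : Γ → Type*} [∀ x, NormedAddCommGroup (H x)] [∀ x, InnerProductSpace ℂ (H x)]
    {F : ℝ → ℝ} (hF_pos : ∀ r, 0 ≤ r → 0 < F r)
    {C : ℝ} (hC : 0 < C) (hF_conv : ConvolutionCondition Γ F C)
    {Φ : (Z : Finset Γ) → ℝ → LocalAlgebra H Z}
    (hΦ_sa : ∀ Z, ∀ t ∈ Set.Icc (0 : ℝ) 1, IsSelfAdjoint (Φ Z t))
    (hΦ_cont : ∀ (Λ : Finset Γ) (ψ : LocalSpace H Λ),
      ContinuousOn (fun t => hamiltonian Φ Λ t ψ) (Set.Icc 0 1))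
    (hΦ_norm : interactionNorm F Φ < ⊤)
    {Λ X Y : Finset Γ} (hX : X ⊆ Λ) (hY : Y ⊆ Λ)
    {U : ℝ → ℝ → LocalAlgebra H Λ} (hU : IsPropagator Φ Λ U)
    (A : LocalAlgebra H X) (B : LocalAlgebra H Y)
    {t : ℝ} (ht : t ∈ Set.Icc (0 : ℝ) 1) :
    ‖⁅heisenberg U t (embed hX A), embed hY B⁆‖ ≤
      2 * ‖A‖ * ‖B‖ *
        min 1 (growth F C (interactionNorm F Φ).toReal X Y t *
          ∑ x ∈ X, ∑ y ∈ Y, F (dist x y)) := by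
  have h0I : (0 : ℝ) ∈ Set.Icc (0 : ℝ) 1 := ⟨le_rfl, zero_le_one⟩
  have hF0 : ∀ x y : Γ, 0 ≤ F (dist x y) := fun x y => (hF_pos _ dist_nonneg).le
  obtain ⟨N, hN⟩ : ∃ N, N = (interactionNorm F Φ).toReal := ⟨_, rfl⟩
  have hN0 : 0 ≤ N := hN ▸ ENNReal.toReal_nonneg
  have htriv : ‖⁅heisenberg U t (embed hX A), embed hY B⁆‖ ≤ 2 * ‖A‖ * ‖B‖ * 1 := by
    refine (norm_lie_le _ _).trans ?_
    rw [heisenberg, norm_star_mul_mul_unitary (hU.unitary t ht 0 h0I), mul_one]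
    have h1 := norm_embed_le hX A
    have h2 := norm_embed_le hY B
    gcongr
  rw [mul_min_of_nonneg _ _ (by positivity)]
  refine le_min htriv ?_
  -- For overlapping sets a common point contributes F(0) to the double sum, so g(t) times the sum
  -- is at least 1 and the trivial bound is enough.
  by_cases hXY : Disjoint X Y
  swap
  · refine htriv.trans (mul_le_mul_of_nonneg_left ?_ (by positivity))
    obtain ⟨x, hx, hy⟩ := Finset.not_disjoint_iff.1 hXY
    rw [growth, if_neg (fun h => hXY (setDist_pos_iff.1 h)), ← hN]
    have hF00 : 0 < F 0 := hF_pos 0 le_rfl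
    have h1 : F 0 ≤ ∑ x ∈ X, ∑ y ∈ Y, F (dist x y) := by
      rw [← dist_self x]
      exact (Finset.single_le_sum (f := fun y => F (dist x y)) (fun y _ => hF0 x y) hy).trans
        (Finset.single_le_sum (f := fun x => ∑ y ∈ Y, F (dist x y))
          (fun x _ => Finset.sum_nonneg fun y _ => hF0 x y) hx)
    have h2 : 1 ≤ Real.exp (2 * N * C * |t|) := Real.one_le_exp (by positivity)
    rw [div_mul_eq_mul_div, le_div_iff₀ hF00, one_mul]
    exact h1.trans (le_mul_of_one_le_left (hF00.le.trans h1) h2)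
  have hproj : ∀ {r : ℝ}, r ∈ Set.Icc (0 : ℝ) 1 →
      (Set.projIcc (0 : ℝ) 1 zero_le_one r : ℝ) = r := fun hr => by
    rw [Set.projIcc_of_mem _ hr]
  -- Freezing the interaction outside [0,1] makes strong continuity and the bounds global in time
  -- without changing the dynamics on [0,1].
  let Ψ : (Z : Finset Γ) → ℝ → LocalAlgebra H Z := fun Z r =>
    Φ Z (Set.projIcc (0 : ℝ) 1 zero_le_one r)
  have hclamp : ∀ Z r, Ψ Z r = Ψ Z (Set.projIcc (0 : ℝ) 1 zero_le_one r) := fun Z r => by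
    simp only [Ψ, Set.projIcc_val]
  have hΨ_ham : ∀ Λ, StrongContinuous (hamiltonian Ψ Λ) := fun Λ ψ =>
    (continuousOn_iff_continuous_domRestrict.1 (hΦ_cont Λ ψ)).comp continuous_projIcc
  have hΨ : ∀ Z, StrongContinuous (Ψ Z) := strongContinuous_of_hamiltonian hclamp hΨ_ham
  have hΨ_sa : ∀ Z r, IsSelfAdjoint (Ψ Z r) := fun Z r => hΦ_sa Z _ (Subtype.prop _)
  obtain ⟨M, hM⟩ := (hΨ ∅).exists_norm_le (hclamp ∅)
  obtain ⟨b, hb, hbF⟩ := exists_interaction_bound hF_pos hΦ_norm (M := M) fun r hr => by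
    have := hM r
    simp only [Ψ, hproj hr] at this
    exact this
  rw [← hN] at hbF
  have hbΨ : ∀ Z r, ‖Ψ Z r‖ ≤ b Z := fun Z r => hb Z _ (Subtype.prop _)
  have hb0 : ∀ Z, 0 ≤ b Z := fun Z => (norm_nonneg _).trans (hbΨ Z 0)
  let q : ℝ → ℝ := fun s => (Real.exp (2 * N * C * s) - 1) / C
  have hq0 : ∀ s, 0 ≤ s → 0 ≤ q s := fun s hs =>
    div_nonneg (sub_nonneg.2 (Real.one_le_exp (by positivity))) hC.le
  have hqC : ∀ s, 1 + C * q s = Real.exp (2 * N * C * s) := fun s => by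
    simp only [q]; field_simp; ring
  -- q solves q' = 2N(1 + Cq) with q(0) = 0 and is convex, so it lies above its tangents: this is
  -- the supersolution property in difference form.
  have hq_step : ∀ s h, q s + 2 * h * (N * (1 + C * q s)) ≤ q (s + h) := fun s h => by
    have h1 := Real.add_one_le_exp (2 * N * C * h)
    have h2 := mul_le_mul_of_nonneg_left h1 (Real.exp_pos (2 * N * C * s)).le
    rw [← Real.exp_add, ← mul_add] at h2
    rw [hqC]
    simp only [q]
    rw [div_add' _ _ _ hC.ne']
    refine div_le_div_of_nonneg_right ?_ hC.le
    linarith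
  let S : Finset Γ → ℝ := fun Z => ∑ z ∈ Z, ∑ y ∈ Y, F (dist z y)
  have hS0 : ∀ Z, 0 ≤ S Z := fun Z =>
    Finset.sum_nonneg fun z _ => Finset.sum_nonneg fun y _ => hF0 z y
  let w : Finset Γ → ℝ → ℝ := fun Z s =>
    2 * ‖B‖ * ((if Disjoint Z Y then 0 else 1) + q s * S Z)
  have hw := norm_lie_le_supersolution hΨ hΨ_sa hbΨ (V := fun r => U r 0)
    (B := embed hY B) (w := w) (fun r hr => hU.unitary r hr 0 h0I)
    (fun ψ r hr => by
      have := hU.deriv 0 h0I ψ r hr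
      simpa only [Ψ, hamiltonian, hproj hr] using this)
    (fun {Z} hZ A => by
      simp only [hU.refl 0 h0I, star_one, one_mul, mul_one]
      -- At time 0 disjoint supports commute, matching w = 0; otherwise the trivial bound 2‖A‖‖B‖
      -- matches the indicator term.
      by_cases hd : Disjoint Z Y
      · rw [(commute_embed hZ hY hd A B).lie_eq, norm_zero]
        simp [w, q, hd]
      · refine (norm_lie_le _ _).trans ?_
        have h1 := norm_embed_le hZ A
        have h2 := norm_embed_le hY B
        simp only [w, q, hd, if_false, mul_zero, Real.exp_zero, sub_self, zero_div, zero_mul,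
          add_zero, mul_one]
        calc 2 * ‖embed hZ A‖ * ‖embed hY B‖ ≤ 2 * ‖A‖ * ‖B‖ := by gcongr
          _ = _ := by ring)
    (fun Z r hr => by
      have := mul_nonneg (hq0 r hr) (hS0 Z)
      refine mul_nonneg (by positivity) (add_nonneg (by split_ifs <;> simp) this))
    (fun Z hZ s h hs hh => by
      have h1 := sum_interaction_le hF_pos (hF_conv.sum_le hF_pos hC.le Λ) hb0 hN0 (hbF Λ) Z Y
        (hq0 s hs)
      have h2 : (∑ W ∈ Λ.powerset, if Disjoint Z W then 0 else b W * w W s) =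
          2 * ‖B‖ * ∑ W ∈ Λ.powerset, if Disjoint Z W then 0 else
            b W * ((if Disjoint W Y then 0 else 1) + q s * ∑ z ∈ W, ∑ y ∈ Y, F (dist z y)) := by
        rw [Finset.mul_sum]
        refine Finset.sum_congr rfl fun W _ => ?_
        by_cases hd : Disjoint Z W
        · simp only [hd, if_true, mul_zero]
        · simp only [hd, if_false, w, S]; ring
      rw [h2]
      have h3 := mul_le_mul_of_nonneg_right (hq_step s h) (hS0 Z)
      have h4 := mul_le_mul_of_nonneg_left h1 (by positivity : 0 ≤ 2 * h)
      have hB : 0 ≤ 2 * ‖B‖ := by positivity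
      have h5 := mul_le_mul_of_nonneg_left
        (add_le_add (le_refl ((if Disjoint Z Y then (0 : ℝ) else 1) + q s * S Z)) h4) hB
      refine le_trans (le_of_eq ?_) (h5.trans (mul_le_mul_of_nonneg_left ?_ hB))
      · simp only [w]; ring
      · change _ + 2 * h * (N * (1 + C * q s) * S Z) ≤ _
        linarith)
    ht hX A
  refine hw.trans (le_of_eq ?_)
  simp only [w, q, S, hXY, if_true, zero_add, growth, if_pos (setDist_pos_iff.2 hXY), ← hN,
    abs_of_nonneg ht.1]
  ring

end QLattice

end

theorem theorem4p4 {Γ : Type*} [MetricSpace Γ] [Countable Γ] [DecidableEq Γ]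
    (H : Γ → Type*) [∀ x, NormedAddCommGroup (H x)] [∀ x, InnerProductSpace ℂ (H x)]
    [∀ x, CompleteSpace (H x)]
    (F : ℝ → ℝ) (hF_pos : ∀ r, 0 ≤ r → 0 < F r) (hF_anti : AntitoneOn F (Set.Ici 0))
    (hF_int : QLattice.uniformSum Γ F < ⊤)
    (C : ℝ) (hC : 0 < C) (hF_conv : QLattice.ConvolutionCondition Γ F C)
    (Φ : (Z : Finset Γ) → ℝ → QLattice.LocalAlgebra H Z)
    (hΦ_sa : ∀ Z, ∀ t ∈ Set.Icc (0 : ℝ) 1, IsSelfAdjoint (Φ Z t))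
    (hΦ_cont : ∀ (Λ : Finset Γ) (ψ : QLattice.LocalSpace H Λ),
      ContinuousOn (fun t => QLattice.hamiltonian Φ Λ t ψ) (Set.Icc 0 1))
    (hΦ_norm : QLattice.interactionNorm F Φ < ⊤)
    (Λ X Y : Finset Γ) (hX : X ⊆ Λ) (hY : Y ⊆ Λ)
    (U : ℝ → ℝ → QLattice.LocalAlgebra H Λ) (hU : QLattice.IsPropagator Φ Λ U)
    (A : QLattice.LocalAlgebra H X) (B : QLattice.LocalAlgebra H Y)
    (t : ℝ) (ht : t ∈ Set.Icc (0 : ℝ) 1) :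
    ‖⁅QLattice.heisenberg U t (QLattice.embed hX A), QLattice.embed hY B⁆‖ ≤
      2 * ‖A‖ * ‖B‖ *
        min 1 (QLattice.growth F C (QLattice.interactionNorm F Φ).toReal X Y t *
          ∑ x ∈ X, ∑ y ∈ Y, F (dist x y)) := 
  QLattice.norm_lie_heisenberg_le hF_pos hC hF_conv hΦ_sa hΦ_cont hΦ_norm hX hY hU A B ht
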